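/- Let $\mathfrak g$ be a finite-dimensional complex reductive Lie algebra, $\mathfrak t\subseteq\mathfrak g$ a Cartan subalgebra, $\Phi\subset\mathfrak t^\vee$ the set of roots, $\mathfrak g_\alpha$ ($\alpha\in\Phi$) the root spaces, and $\alpha^\vee\in[\mathfrak g_\alpha,\mathfrak g_{-\alpha}]\subseteq\mathfrak t$ the coroot of $\alpha$; write $\phi^\vee=\{\alpha^\vee:\alpha\in\phi\}$ for $\phi\subseteq\Phi$. Let $r\ge 1$ and $\mathfrak g_r=\mathfrak g\otimes\mathbb C[z]/(z^r)=\bigoplus_{i=0}^{r-1}\mathfrak g\,\varepsilon^i$, with $\varepsilon$ the class of $z$. A subset $\psi\subseteq\Phi$ is parabolic if $(\psi+\psi)\cap\Phi\subseteq\psi$ and $\psi\cup(-\psi)=\Phi$. Let $\boldsymbol\psi=(\psi_0\subseteq\psi_1\subseteq\cdots)$ be a sequence of parabolic subsets of $\Phi$ with $\psi_r=\Phi$. Put $\phi_i=\psi_i\cap(-\psi_i)$, $\nu_i=\psi_i\setminus\phi_i$, and define the subspaces $$\mathfrak p_{\boldsymbol\psi}=\bigoplus_{i=0}^{r-1}\Bigl(\mathfrak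 t\oplus\bigoplus_{\alpha\in\psi_i}\mathfrak g_\alpha\Bigr)\varepsilon^i,\quad \mathfrak l_{\boldsymbol\phi}=\bigoplus_{i=0}^{r-1}\Bigl(\mathfrak t\oplus\bigoplus_{\alpha\in\phi_i}\mathfrak g_\alpha\Bigr)\varepsilon^i,\quad \mathfrak u^\pm_{\boldsymbol\psi}=\bigoplus_{i=0}^{r-1}\Bigl(\bigoplus_{\alpha\in\nu_i}\mathfrak g_{\pm\alpha}\Bigr)\varepsilon^i$$ of $\mathfrak g_r$; the first two are Lie subalgebras ($\mathfrak p_{\boldsymbol\psi}$ is the finite singularity algebra of polarisation $\boldsymbol\psi$), and $\mathfrak g_r=\mathfrak u^-_{\boldsymbol\psi}\oplus\mathfrak l_{\boldsymbol\phi}\oplus\mathfrak u^+_{\boldsymbol\psi}$. Let $\pi_{\boldsymbol\phi}:\mathfrak g_r\to\mathfrak l_{\boldsymbol\phi}$ be the projection along $\mathfrak u^-_{\boldsymbol\psi}\oplus\mathfrak u^+_{\boldsymbol\psi}$. Let $\boldsymbol\chi:\mathfrak p_{\boldsymbol\psi}\to\mathbb C$ be a character (a morphism of Lie algebras), and let $\boldsymbol\lambda=(\lambda_0,\dots,\lambda_{r-1})\in(\mathfrak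 t^\vee)^r$ be its covector, $\lambda_i(X)=\boldsymbol\chi(X\varepsilon^i)$ for $X\in\mathfrak t$. Regard $\boldsymbol\lambda$ also as the element of $\mathfrak g_r^\vee$ that sends $X\varepsilon^i$ to $\lambda_i(X)$ for $X\in\mathfrak t$ and vanishes on every $\mathfrak g_\alpha\varepsilon^i$; let $\mathfrak g_r^{\boldsymbol\lambda}=\{Y\in\mathfrak g_r:\boldsymbol\lambda([Y,Z])=0\ \forall Z\in\mathfrak g_r\}$ be its infinitesimal coadjoint stabiliser, and let $\omega_{\boldsymbol\lambda}(Y,Z)=\boldsymbol\lambda([Y,Z])$ be the Kirillov-Kostant-Souriau form of its coadjoint orbit $\mathcal O_{\boldsymbol\lambda}$ on $T_{\boldsymbol\lambda}\mathcal O_{\boldsymbol\lambda}=\mathfrak g_r/\mathfrak g_r^{\boldsymbol\lambda}$. Let $$B^{\boldsymbol\psi}_{\boldsymbol\lambda}:\mathfrak u^+_{\boldsymbol\psi}\otimes\mathfrak u^-_{\boldsymbol\psi}\to\mathbb C,\qquad B^{\boldsymbol\psi}_{\boldsymbol\lambda}(Y,Y')=\boldsymbol\chi\bigl(\pi_{\boldsymbol\phi}([Y,Y'])\bigr).$$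 A character of $\mathfrak l_{\boldsymbol\phi}$ is called nonsingular if it extends, by zero on $\mathfrak u^+_{\boldsymbol\psi}$, to a character of $\mathfrak p_{\boldsymbol\psi}$, and the pairing on $\mathfrak u^+_{\boldsymbol\psi}\otimes\mathfrak u^-_{\boldsymbol\psi}$ defined from it in this way is nondegenerate. Then the following are equivalent: 1. the restriction $\boldsymbol\chi|_{\mathfrak l_{\boldsymbol\phi}}$ is nonsingular; 2. the pairing $B^{\boldsymbol\psi}_{\boldsymbol\lambda}$ is nondegenerate; 3. $\boldsymbol\lambda$ lies in the dual wild stratum of $(\mathfrak t^\vee)^r\simeq\mathfrak t_r^\vee$ attached to the dual Levi filtration $\boldsymbol\phi^\vee=(\phi_0^\vee\subseteq\phi_1^\vee\subseteq\cdots\subseteq\phi_r^\vee=\Phi^\vee)$, that is, for each $i\in\{0,\dots,r-1\}$ one has $\lambda_i(\alpha^\vee)=0$ for all $\alpha^\vee\in\phi_i^\vee$ and $\lambda_i(\alpha^\vee)\neq0$ for all $\alpha^\vee\in\phi_{i+1}^\vee\setminus\phi_i^\vee$; 4. $B^{\boldsymbol\psi}_{\boldsymbol\lambda}$ is the restriction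 to $\mathfrak u^+_{\boldsymbol\psi}\otimes\mathfrak u^-_{\boldsymbol\psi}$ of the KKS form $\omega_{\boldsymbol\lambda}$, i.e. $\mathfrak u^+_{\boldsymbol\psi}\oplus\mathfrak u^-_{\boldsymbol\psi}$ is mapped injectively to $T_{\boldsymbol\lambda}\mathcal O_{\boldsymbol\lambda}=\mathfrak g_r/\mathfrak g_r^{\boldsymbol\lambda}$ and $B^{\boldsymbol\psi}_{\boldsymbol\lambda}(Y,Y')=\omega_{\boldsymbol\lambda}(Y,Y')$ for all $Y\in\mathfrak u^+_{\boldsymbol\psi}$, $Y'\in\mathfrak u^-_{\boldsymbol\psi}$; 5. $\mathfrak l_{\boldsymbol\phi}=\mathfrak g_r^{\boldsymbol\lambda}$. -/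

import Mathlib

open scoped Pointwise

set_option linter.unusedSectionVars false

namespace WildKKS

section Tcla

/-- The truncated current Lie algebra `𝔤 ⊗ ℂ[z]/(z^r)`.  An element `∑ X_i ε^i` is stored as the
family of its coefficients `X_0, …, X_{r-1}`. -/
def Tcla (𝔤 : Type*) (r : ℕ) : Type _ := Fin r → 𝔤

variable {𝔤 : Type*} [LieRing 𝔤] [LieAlgebra ℂ 𝔤] {r : ℕ}

instance : AddCommGroup (Tcla 𝔤 r) := inferInstanceAs (AddCommGroup (Fin r → 𝔤))

instance : Module ℂ (Tcla 𝔤 r) := inferInstanceAs (Module ℂ (Fin r → 𝔤))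

instance [FiniteDimensional ℂ 𝔤] : FiniteDimensional ℂ (Tcla 𝔤 r) :=
  inferInstanceAs (FiniteDimensional ℂ (Fin r → 𝔤))

/-- `[∑ X_i ε^i, ∑ Y_j ε^j] = ∑_k (∑_{i+j=k} [X_i, Y_j]) ε^k`, with `ε^r = 0`. -/
instance : Bracket (Tcla 𝔤 r) (Tcla 𝔤 r) :=
  ⟨fun X Y k => ∑ i : Fin r, ∑ j : Fin r, if (i : ℕ) + j = k then ⁅X i, Y j⁆ else 0⟩

theorem Tcla.lie_apply (X Y : Tcla 𝔤 r) (k : Fin r) :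
    ⁅X, Y⁆ k = ∑ i : Fin r, ∑ j : Fin r, if (i : ℕ) + j = k then ⁅X i, Y j⁆ else 0 := rfl

@[simp] theorem Tcla.add_apply (X Y : Tcla 𝔤 r) (k : Fin r) : (X + Y) k = X k + Y k := rfl

@[simp] theorem Tcla.smul_apply (c : ℂ) (X : Tcla 𝔤 r) (k : Fin r) : (c • X) k = c • X k := rfl

@[simp] theorem Tcla.zero_apply (k : Fin r) : (0 : Tcla 𝔤 r) k = 0 := rfl

@[ext] theorem Tcla.ext {X Y : Tcla 𝔤 r} (h : ∀ k, X k = Y k) : X = Y := funext h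

theorem Tcla.lie_lie_apply (X Y Z : Tcla 𝔤 r) (k : Fin r) :
    ⁅X, ⁅Y, Z⁆⁆ k = ∑ i : Fin r, ∑ a : Fin r, ∑ b : Fin r,
      if (i : ℕ) + a + b = k then ⁅X i, ⁅Y a, Z b⁆⁆ else 0 := by
  rw [Tcla.lie_apply]
  refine Finset.sum_congr rfl fun i _ => ?_
  have h1 : ∀ m : Fin r, (if (i : ℕ) + m = k then ⁅X i, ⁅Y, Z⁆ m⁆ else 0) =
      ∑ a : Fin r, ∑ b : Fin r,
        if (i : ℕ) + m = k ∧ (a : ℕ) + b = m then ⁅X i, ⁅Y a, Z b⁆⁆ else 0 := by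
    intro m
    rw [Tcla.lie_apply]
    split_ifs with h
    · rw [lie_sum]
      refine Finset.sum_congr rfl fun a _ => ?_
      rw [lie_sum]
      refine Finset.sum_congr rfl fun b _ => ?_
      by_cases h' : (a : ℕ) + b = m <;> simp [h, h']
    · simp [h]
  rw [Finset.sum_congr rfl fun m _ => h1 m, Finset.sum_comm]
  refine Finset.sum_congr rfl fun a _ => ?_
  rw [Finset.sum_comm]
  refine Finset.sum_congr rfl fun b _ => ?_
  by_cases h : (i : ℕ) + a + b = k
  · have hlt : (a : ℕ) + b < r := by have := k.2; omega
    rw [Finset.sum_eq_single (⟨(a : ℕ) + b, hlt⟩ : Fin r)]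
    · simp [h, ← add_assoc]
    · intro m _ hm
      rw [if_neg]
      rintro ⟨-, h2⟩
      exact hm (Fin.ext h2.symm)
    · simp
  · rw [if_neg h]
    refine Finset.sum_eq_zero fun m _ => if_neg ?_
    rintro ⟨h2, h3⟩
    omega

theorem Tcla.lie_anti (X Y : Tcla 𝔤 r) : ⁅X, Y⁆ = -⁅Y, X⁆ := by
  rw [eq_neg_iff_add_eq_zero]
  ext k
  rw [Tcla.add_apply, Tcla.lie_apply, Tcla.lie_apply, Finset.sum_comm, ← Finset.sum_add_distrib]
  refine Finset.sum_eq_zero fun i _ => ?_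
  rw [← Finset.sum_add_distrib]
  refine Finset.sum_eq_zero fun j _ => ?_
  rw [add_comm (j : ℕ) i]
  split_ifs
  · rw [← lie_skew, neg_add_cancel]
  · simp

theorem Tcla.lie_add' (X Y Z : Tcla 𝔤 r) : ⁅X, Y + Z⁆ = ⁅X, Y⁆ + ⁅X, Z⁆ := by
  ext k
  simp only [Tcla.add_apply, Tcla.lie_apply, ← Finset.sum_add_distrib, lie_add]
  refine Finset.sum_congr rfl fun i _ => Finset.sum_congr rfl fun j _ => ?_
  split_ifs <;> simp

theorem Tcla.add_lie' (X Y Z : Tcla 𝔤 r) : ⁅X + Y, Z⁆ = ⁅X, Z⁆ + ⁅Y, Z⁆ := by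
  rw [Tcla.lie_anti, Tcla.lie_add', neg_add, ← Tcla.lie_anti, ← Tcla.lie_anti]

instance : LieRing (Tcla 𝔤 r) where
  add_lie := Tcla.add_lie'
  lie_add := Tcla.lie_add'
  lie_self X := by
    have h := Tcla.lie_anti X X
    have h2 : (2 : ℂ) • ⁅X, X⁆ = 0 := by
      rw [two_smul]; nth_rw 1 [h]; exact neg_add_cancel _
    exact (smul_eq_zero.mp h2).resolve_left two_ne_zero
  leibniz_lie X Y Z := by
    rw [Tcla.lie_anti ⁅X, Y⁆ Z]
    ext k
    have hneg : ∀ W : Tcla 𝔤 r, (-W) k = -(W k) := fun _ => rfl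
    rw [Tcla.add_apply, hneg, Tcla.lie_lie_apply, Tcla.lie_lie_apply, Tcla.lie_lie_apply]
    have e1 : (∑ i : Fin r, ∑ a : Fin r, ∑ b : Fin r,
        if (i : ℕ) + a + b = k then ⁅Z i, ⁅X a, Y b⁆⁆ else 0) =
        ∑ i : Fin r, ∑ a : Fin r, ∑ b : Fin r,
        if (i : ℕ) + a + b = k then ⁅Z b, ⁅X i, Y a⁆⁆ else 0 := by
      rw [Finset.sum_comm]
      refine Finset.sum_congr rfl fun i _ => ?_
      rw [Finset.sum_comm]
      refine Finset.sum_congr rfl fun a _ => Finset.sum_congr rfl fun b _ => ?_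
      rw [show (b : ℕ) + i + a = i + a + b by omega]
    have e2 : (∑ i : Fin r, ∑ a : Fin r, ∑ b : Fin r,
        if (i : ℕ) + a + b = k then ⁅Y i, ⁅X a, Z b⁆⁆ else 0) =
        ∑ i : Fin r, ∑ a : Fin r, ∑ b : Fin r,
        if (i : ℕ) + a + b = k then ⁅Y a, ⁅X i, Z b⁆⁆ else 0 := by
      rw [Finset.sum_comm]
      refine Finset.sum_congr rfl fun i _ => Finset.sum_congr rfl fun a _ =>
        Finset.sum_congr rfl fun b _ => ?_
      rw [show (a : ℕ) + i + b = i + a + b by omega]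
    rw [e1, e2]
    simp only [← Finset.sum_neg_distrib, ← Finset.sum_add_distrib]
    refine Finset.sum_congr rfl fun i _ => Finset.sum_congr rfl fun a _ =>
      Finset.sum_congr rfl fun b _ => ?_
    split_ifs
    · rw [leibniz_lie, ← lie_skew (Z b)]
      simp
    · simp

instance : LieAlgebra ℂ (Tcla 𝔤 r) where
  lie_smul c X Y := by
    ext k
    simp only [Tcla.smul_apply, Tcla.lie_apply, lie_smul, Finset.smul_sum, smul_ite, smul_zero]

/-- The subspace `⊕_i V_i ε^i` of `𝔤 ⊗ ℂ[z]/(z^r)`. -/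
def graded (r : ℕ) (V : ℕ → Submodule ℂ 𝔤) : Submodule ℂ (Tcla 𝔤 r) where
  carrier := {Y | ∀ i : Fin r, Y i ∈ V i}
  add_mem' hX hY i := (V i).add_mem (hX i) (hY i)
  zero_mem' i := (V i).zero_mem
  smul_mem' c _ hX i := (V i).smul_mem c (hX i)

/-- The pure tensor `X ε^i`. -/
def mono (i : Fin r) : 𝔤 →ₗ[ℂ] Tcla 𝔤 r := LinearMap.single ℂ (fun _ : Fin r => 𝔤) i

theorem mono_mem_graded {V : ℕ → Submodule ℂ 𝔤} {i : Fin r} {x : 𝔤} (hx : x ∈ V i) :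
    mono i x ∈ graded r V := by
  intro j
  by_cases h : j = i
  · subst h
    have : mono (r := r) j x j = x := Pi.single_eq_same (M := fun _ : Fin r => 𝔤) j x
    rwa [this]
  · have : mono (r := r) i x j = 0 := Pi.single_eq_of_ne (M := fun _ : Fin r => 𝔤) h x
    rw [this]
    exact (V j).zero_mem

theorem graded_mono {V W : ℕ → Submodule ℂ 𝔤} (h : ∀ i, V i ≤ W i) : graded r V ≤ graded r W :=
  fun _ hY i => h i (hY i)

theorem isCompl_graded {P M Q : ℕ → Submodule ℂ 𝔤} (h : ∀ i, IsCompl (P i) (M i ⊔ Q i)) :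
    IsCompl (graded r P) (graded r M ⊔ graded r Q) := by
  constructor
  · rw [Submodule.disjoint_def]
    intro Y hP hMQ
    ext i
    refine Submodule.disjoint_def.mp (h i).disjoint (Y i) (hP i) ?_
    obtain ⟨A, hA, B, hB, rfl⟩ := Submodule.mem_sup.mp hMQ
    exact Submodule.add_mem_sup (hA i) (hB i)
  · rw [codisjoint_iff, eq_top_iff]
    intro Y _
    have key : ∀ i : Fin r, ∃ a b c : 𝔤, a ∈ P i ∧ b ∈ M i ∧ c ∈ Q i ∧ a + (b + c) = Y i := by
      intro i
      have hy : Y i ∈ P i ⊔ (M i ⊔ Q i) := by rw [(h i).sup_eq_top]; trivial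
      obtain ⟨a, ha, d, hd, h1⟩ := Submodule.mem_sup.mp hy
      obtain ⟨b, hb, c, hc, rfl⟩ := Submodule.mem_sup.mp hd
      exact ⟨a, b, c, ha, hb, hc, h1⟩
    choose a b c ha hb hc hs using key
    have : Y = (show Tcla 𝔤 r from a) + ((show Tcla 𝔤 r from b) + (show Tcla 𝔤 r from c)) :=
      Tcla.ext fun i => (hs i).symm
    rw [this]
    exact Submodule.add_mem_sup ha (Submodule.add_mem_sup hb hc)

end Tcla

section Coadjoint

variable {V : Type*} [LieRing V] [LieAlgebra ℂ V]

/-- The linear part of the Poisson bracket of the dual of `V`, evaluated at the covector `f`: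
`(Y, Z) ↦ ⟨f, [Y, Z]⟩`. -/
noncomputable def poissonAt (f : Module.Dual ℂ V) : LinearMap.BilinForm ℂ V :=
  LinearMap.mk₂ ℂ (fun Y Z => f ⁅Y, Z⁆) (by simp) (by simp) (by simp) (by simp)

@[simp] theorem poissonAt_apply (f : Module.Dual ℂ V) (Y Z : V) : poissonAt f Y Z = f ⁅Y, Z⁆ := rfl

/-- The infinitesimal stabiliser of a covector for the coadjoint action
`(Y · f)(Z) = - f [Y, Z]`. -/
def coadjointStabiliser (f : Module.Dual ℂ V) : LieSubalgebra ℂ V where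
  carrier := {Y | ⁅Y, f⁆ = 0}
  add_mem' {X Y} hX hY := by
    simp only [Set.mem_ofPred_eq] at *
    rw [add_lie, hX, hY, add_zero]
  zero_mem' := zero_lie f
  smul_mem' c X hX := by
    simp only [Set.mem_ofPred_eq] at *
    rw [smul_lie, hX, smul_zero]
  lie_mem' {X Y} hX hY := by
    change ⁅X, f⁆ = 0 at hX
    change ⁅Y, f⁆ = 0 at hY
    change ⁅⁅X, Y⁆, f⁆ = 0
    rw [lie_lie, hX, hY, lie_zero, lie_zero, sub_zero]

theorem apply_lie_of_mem_stabiliser {f : Module.Dual ℂ V} {Y : V}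
    (hY : Y ∈ coadjointStabiliser f) (Z : V) : f ⁅Y, Z⁆ = 0 := by
  have h : ⁅Y, f⁆ = 0 := hY
  have h2 := LinearMap.congr_fun h Z
  simpa using h2

/-- The tangent space at `f` of the coadjoint orbit of `f`: the quotient of `V` by the
infinitesimal coadjoint stabiliser. -/
abbrev OrbitTangent (f : Module.Dual ℂ V) : Type _ := V ⧸ (coadjointStabiliser f).toSubmodule

/-- The Kirillov–Kostant–Souriau form of the coadjoint orbit of `f`, evaluated at `f`: the form
induced by the Poisson bracket at `f` on the quotient by its radical. -/
noncomputable def kksForm (f : Module.Dual ℂ V) : LinearMap.BilinForm ℂ (OrbitTangent f) :=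
  (coadjointStabiliser f).toSubmodule.liftQ
    { toFun := fun Y => (coadjointStabiliser f).toSubmodule.liftQ (poissonAt f Y) (by
        intro Z hZ
        rw [LinearMap.mem_ker, poissonAt_apply, ← lie_skew, map_neg,
          apply_lie_of_mem_stabiliser hZ, neg_zero])
      map_add' := fun X Y => by
        ext Z
        simp
      map_smul' := fun c X => by
        ext Z
        simp }
    (by
      intro Y hY
      rw [LinearMap.mem_ker]
      ext Z
      simpa using apply_lie_of_mem_stabiliser hY Z)

@[simp] theorem kksForm_mk (f : Module.Dual ℂ V) (Y Z : V) :
    kksForm f (Submodule.Quotient.mk Y) (Submodule.Quotient.mk Z) = f ⁅Y, Z⁆ := rfl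

end Coadjoint

section Roots

variable {𝔤 : Type*} [LieRing 𝔤] [LieAlgebra ℂ 𝔤] [FiniteDimensional ℂ 𝔤]
  (𝔱 : LieSubalgebra ℂ 𝔤) [𝔱.IsCartanSubalgebra]

/-- The set of roots of `𝔤` with respect to `𝔱`. -/
def roots : Set (Module.Dual ℂ 𝔱) := {α | α ≠ 0 ∧ LieAlgebra.rootSpace 𝔱 α ≠ ⊥}

/-- The sum of the root spaces `𝔤_α` with `α ∈ S`. -/
def rootSum (S : Set (Module.Dual ℂ 𝔱)) : Submodule ℂ 𝔤 :=
  ⨆ α ∈ S, (LieAlgebra.rootSpace 𝔱 α).toSubmodule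

/-- The coroots `α^∨` of the roots `α ∈ S`; here `α^∨` is the element of `[𝔤_α, 𝔤_{-α}]` with
`⟨α, α^∨⟩ = 2`. -/
def coroots (S : Set (Module.Dual ℂ 𝔱)) : Set 𝔱 :=
  {h | ∃ α ∈ S, h ∈ LieAlgebra.corootSpace (α : 𝔱 → ℂ) ∧ α h = 2}

/-- Parabolic subsets of the root system. -/
structure IsParabolic (ψ : Set (Module.Dual ℂ 𝔱)) : Prop where
  closed : (ψ + ψ) ∩ roots 𝔱 ⊆ ψ
  union_neg : ψ ∪ -ψ = roots 𝔱

/-- Parabolic filtrations: nondecreasing exhaustive sequences of parabolic subsets. -/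
structure ParabolicFiltration where
  /-- the terms of the filtration -/
  set : ℕ → Set (Module.Dual ℂ 𝔱)
  subset_succ : ∀ i, set i ⊆ set (i + 1)
  parabolic : ∀ i, IsParabolic 𝔱 (set i)
  exhaustive : ⋃ i, set i = roots 𝔱

variable {𝔱}

theorem rootSum_singleton_zero : rootSum 𝔱 {0} = 𝔱.toSubmodule := by
  have h := LieAlgebra.rootSpace_zero_eq ℂ 𝔤 𝔱
  simp only [rootSum, Set.mem_singleton_iff, iSup_iSup_eq_left]
  change (LieAlgebra.rootSpace 𝔱 (0 : 𝔱 → ℂ)).toSubmodule = _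
  rw [h, LieSubalgebra.coe_toLieSubmodule]

theorem rootSum_union (A B : Set (Module.Dual ℂ 𝔱)) :
    rootSum 𝔱 (A ∪ B) = rootSum 𝔱 A ⊔ rootSum 𝔱 B := iSup_union

theorem rootSum_mono {A B : Set (Module.Dual ℂ 𝔱)} (h : A ⊆ B) : rootSum 𝔱 A ≤ rootSum 𝔱 B :=
  biSup_mono h

theorem cartan_sup_rootSum (A : Set (Module.Dual ℂ 𝔱)) :
    𝔱.toSubmodule ⊔ rootSum 𝔱 A = rootSum 𝔱 ({0} ∪ A) := by
  rw [rootSum_union, rootSum_singleton_zero]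

theorem isCompl_rootSum {A B : Set (Module.Dual ℂ 𝔱)} (hd : Disjoint A B)
    (hu : {0} ∪ roots 𝔱 ⊆ A ∪ B) : IsCompl (rootSum 𝔱 A) (rootSum 𝔱 B) := by
  constructor
  · have hi := LieModule.iSupIndep_genWeightSpace ℂ 𝔱 𝔤
    rw [← LieSubmodule.iSupIndep_toSubmodule] at hi
    have hi' := hi.comp (f := fun α : Module.Dual ℂ 𝔱 => (α : 𝔱 → ℂ)) DFunLike.coe_injective
    exact hi'.disjoint_biSup_biSup hd
  · rw [codisjoint_iff, ← rootSum_union, eq_top_iff]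
    refine le_trans ?_ (rootSum_mono hu)
    have h := LieModule.iSup_genWeightSpace_eq_top' ℂ 𝔱 𝔤
    rw [← LieSubmodule.toSubmodule_inj, LieSubmodule.iSup_toSubmodule,
      LieSubmodule.top_toSubmodule] at h
    rw [← h]
    refine iSup_le fun χ => ?_
    refine le_trans (b := (LieAlgebra.rootSpace 𝔱 (χ.toLinear ℂ 𝔱 𝔤 : Module.Dual ℂ 𝔱)).toSubmodule)
      le_rfl ?_
    refine le_biSup (fun α : Module.Dual ℂ 𝔱 => (LieAlgebra.rootSpace 𝔱 α).toSubmodule) ?_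
    by_cases h0 : (χ.toLinear ℂ 𝔱 𝔤 : Module.Dual ℂ 𝔱) = 0
    · exact Or.inl h0
    · exact Or.inr ⟨h0, χ.genWeightSpace_ne_bot⟩

theorem lie_mem_of_closed {C : Set (Module.Dual ℂ 𝔱)} (hC : (C + C) ∩ roots 𝔱 ⊆ C) {x y : 𝔤}
    (hx : x ∈ 𝔱.toSubmodule ⊔ rootSum 𝔱 C) (hy : y ∈ 𝔱.toSubmodule ⊔ rootSum 𝔱 C) :
    ⁅x, y⁆ ∈ 𝔱.toSubmodule ⊔ rootSum 𝔱 C := by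
  rw [cartan_sup_rootSum] at *
  have hadd : ∀ α ∈ ({0} ∪ C : Set (Module.Dual ℂ 𝔱)), ∀ β ∈ ({0} ∪ C : Set (Module.Dual ℂ 𝔱)),
      LieAlgebra.rootSpace 𝔱 (α + β : Module.Dual ℂ 𝔱) ≠ ⊥ →
      α + β ∈ ({0} ∪ C : Set (Module.Dual ℂ 𝔱)) := by
    intro α hα β hβ hne
    by_cases h0 : α + β = 0
    · exact Or.inl h0
    · right
      rcases hα with hα | hα
      · rw [Set.mem_singleton_iff] at hα
        subst hα
        rcases hβ with hβ | hβ
        · exact absurd (by rw [hβ, add_zero]) h0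
        · rwa [zero_add]
      · rcases hβ with hβ | hβ
        · rw [Set.mem_singleton_iff] at hβ
          subst hβ
          rwa [add_zero]
        · exact hC ⟨Set.add_mem_add hα hβ, h0, hne⟩
  have hle : rootSum 𝔱 ({0} ∪ C) ≤
      Submodule.comap (LieModule.toEnd ℂ 𝔤 𝔤 x : 𝔤 →ₗ[ℂ] 𝔤) (rootSum 𝔱 ({0} ∪ C)) := by
    refine iSup₂_le fun β hβ z hz => ?_
    rw [Submodule.mem_comap, LieModule.toEnd_apply_apply]
    have hle2 : rootSum 𝔱 ({0} ∪ C) ≤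
        Submodule.comap (LieModule.toEnd ℂ 𝔤 𝔤 z : 𝔤 →ₗ[ℂ] 𝔤) (rootSum 𝔱 ({0} ∪ C)) := by
      refine iSup₂_le fun α hα w hw => ?_
      rw [Submodule.mem_comap, LieModule.toEnd_apply_apply, ← lie_skew]
      refine Submodule.neg_mem _ ?_
      have hm : ⁅w, z⁆ ∈ LieAlgebra.rootSpace 𝔱 ((α + β : Module.Dual ℂ 𝔱) : 𝔱 → ℂ) :=
        LieAlgebra.lie_mem_genWeightSpace_of_mem_genWeightSpace hw hz
      by_cases hb : LieAlgebra.rootSpace 𝔱 ((α + β : Module.Dual ℂ 𝔱) : 𝔱 → ℂ) = ⊥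
      · rw [hb, LieSubmodule.mem_bot] at hm
        rw [hm]
        exact Submodule.zero_mem _
      · exact Submodule.mem_iSup_of_mem (α + β)
          (Submodule.mem_iSup_of_mem (hadd α hα β hβ hb) hm)
    have := hle2 hx
    rw [Submodule.mem_comap, LieModule.toEnd_apply_apply] at this
    rw [← lie_skew]
    exact Submodule.neg_mem _ this
  exact hle hy

/-- For a nondecreasing sequence of closed sets of roots `S_i`, the Lie subalgebra
`⊕_i (𝔱 ⊕ ⊕_{α ∈ S_i} 𝔤_α) ε^i`. -/
def gradedSubalgebra (r : ℕ) (S : ℕ → Set (Module.Dual ℂ 𝔱)) (hmono : Monotone S)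
    (hS : ∀ i, (S i + S i) ∩ roots 𝔱 ⊆ S i) : LieSubalgebra ℂ (Tcla 𝔤 r) where
  __ := graded r fun i => 𝔱.toSubmodule ⊔ rootSum 𝔱 (S i)
  lie_mem' {X Y} hX hY := by
    intro k
    rw [Tcla.lie_apply]
    refine Submodule.sum_mem _ fun i _ => Submodule.sum_mem _ fun j _ => ?_
    split_ifs with h
    · refine lie_mem_of_closed (hS k) ?_ ?_
      · exact sup_le_sup le_rfl (rootSum_mono (hmono (by omega))) (hX i)
      · exact sup_le_sup le_rfl (rootSum_mono (hmono (by omega))) (hY j)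
    · exact Submodule.zero_mem _

/-- The projection of `𝔤` onto `𝔱` along the sum of the root spaces. -/
noncomputable def cartanProj : 𝔤 →ₗ[ℂ] 𝔱 :=
  Submodule.projectionOnto 𝔱.toSubmodule (rootSum 𝔱 (roots 𝔱)) (by
    rw [← rootSum_singleton_zero]
    exact isCompl_rootSum (by simp [roots]) le_rfl)

/-- A tuple `(λ_0, …, λ_{r-1})` of covectors of `𝔱` as a linear functional on
`𝔤 ⊗ ℂ[z]/(z^r)` that vanishes on all the `𝔤_α ε^i`: `∑ Y_i ε^i ↦ ∑ ⟨λ_i, Y_i⟩`. -/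
noncomputable def extendByZero {r : ℕ} (lam : Fin r → Module.Dual ℂ 𝔱) :
    Module.Dual ℂ (Tcla 𝔤 r) :=
  ∑ i : Fin r, lam i ∘ₗ cartanProj ∘ₗ (LinearMap.proj i : (Fin r → 𝔤) →ₗ[ℂ] 𝔤)

/-- The (truncated) wild stratum of the dual of `𝔱 ⊗ ℂ[z]/(z^r)` attached to a sequence of sets of
coroots. -/
def dualWildStratum (r : ℕ) (φ : ℕ → Set 𝔱) : Set (Fin r → Module.Dual ℂ 𝔱) :=
  {lam | ∀ i : Fin r, (∀ h ∈ φ i, lam i h = 0) ∧ ∀ h ∈ φ (i + 1) \ φ i, lam i h ≠ 0}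

end Roots

namespace ParabolicFiltration

variable {𝔤 : Type*} [LieRing 𝔤] [LieAlgebra ℂ 𝔤] [FiniteDimensional ℂ 𝔤]
  {𝔱 : LieSubalgebra ℂ 𝔤} [𝔱.IsCartanSubalgebra] (ψ : ParabolicFiltration 𝔱) (r : ℕ)

/-- The Levi factor `φ_i = ψ_i ∩ (-ψ_i)`. -/
def levi (i : ℕ) : Set (Module.Dual ℂ 𝔱) := ψ.set i ∩ -ψ.set i

/-- The roots `ν_i = ψ_i ∖ φ_i` of the nilradical. -/
def nil (i : ℕ) : Set (Module.Dual ℂ 𝔱) := ψ.set i \ ψ.levi i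

/-- The dual Levi filtration `φ^∨`, consisting of the coroots of the roots in `φ_i`. -/
def dualLevi (i : ℕ) : Set 𝔱 := coroots 𝔱 (ψ.levi i)

theorem monotone_set : Monotone ψ.set := monotone_nat_of_le_succ ψ.subset_succ

theorem monotone_levi : Monotone ψ.levi := fun _ _ h =>
  Set.inter_subset_inter (ψ.monotone_set h) (Set.neg_subset_neg.mpr (ψ.monotone_set h))

theorem neg_mem_roots (ψ : ParabolicFiltration 𝔱) {α : Module.Dual ℂ 𝔱} (h : α ∈ roots 𝔱) : -α ∈ roots 𝔱 := by
  rw [← (ψ.parabolic 0).union_neg] at h ⊢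
  rcases h with h | h
  · exact Or.inr (by simpa using h)
  · exact Or.inl h

theorem levi_closed (i : ℕ) : (ψ.levi i + ψ.levi i) ∩ roots 𝔱 ⊆ ψ.levi i := by
  rintro _ ⟨⟨α, hα, β, hβ, rfl⟩, hr⟩
  refine ⟨(ψ.parabolic i).closed ⟨Set.add_mem_add hα.1 hβ.1, hr⟩, ?_⟩
  rw [Set.mem_neg]
  refine (ψ.parabolic i).closed ⟨?_, ψ.neg_mem_roots hr⟩
  change -(α + β) ∈ _
  rw [neg_add]
  exact Set.add_mem_add hα.2 hβ.2

/-- The finite singularity algebra `𝔭_ψ = ⊕_i 𝔭_{ψ_i} ε^i`, where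
`𝔭_{ψ_i} = 𝔱 ⊕ ⊕_{α ∈ ψ_i} 𝔤_α`. -/
def singularityAlgebra : LieSubalgebra ℂ (Tcla 𝔤 r) :=
  gradedSubalgebra r ψ.set ψ.monotone_set fun i => (ψ.parabolic i).closed

/-- The deeper Levi factor `𝔩_φ = ⊕_i 𝔩_{φ_i} ε^i`, where `𝔩_{φ_i} = 𝔱 ⊕ ⊕_{α ∈ φ_i} 𝔤_α`. -/
def leviAlgebra : LieSubalgebra ℂ (Tcla 𝔤 r) :=
  gradedSubalgebra r ψ.levi ψ.monotone_levi ψ.levi_closed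

/-- `𝔲^+_ψ = ⊕_i 𝔲^+_{ψ_i} ε^i`, where `𝔲^+_{ψ_i} = ⊕_{α ∈ ν_i} 𝔤_α`. -/
def uPlus : Submodule ℂ (Tcla 𝔤 r) := graded r fun i => rootSum 𝔱 (ψ.nil i)

/-- `𝔲^-_ψ = ⊕_i 𝔲^-_{ψ_i} ε^i`, where `𝔲^-_{ψ_i} = ⊕_{α ∈ ν_i} 𝔤_{-α}`. -/
def uMinus : Submodule ℂ (Tcla 𝔤 r) := graded r fun i => rootSum 𝔱 (-ψ.nil i)

theorem levi_le : ψ.leviAlgebra r ≤ ψ.singularityAlgebra r :=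
  graded_mono (r := r) fun _ => sup_le_sup le_rfl (rootSum_mono Set.inter_subset_left)

theorem uPlus_le : ψ.uPlus r ≤ (ψ.singularityAlgebra r).toSubmodule :=
  graded_mono (r := r) fun _ => le_sup_of_le_right (rootSum_mono Set.sdiff_subset)

theorem isCompl_levi :
    IsCompl (ψ.leviAlgebra r).toSubmodule (ψ.uMinus r ⊔ ψ.uPlus r) := by
  refine isCompl_graded (P := fun i => 𝔱.toSubmodule ⊔ rootSum 𝔱 (ψ.levi i))
    (M := fun i => rootSum 𝔱 (-ψ.nil i)) (Q := fun i => rootSum 𝔱 (ψ.nil i)) fun i => ?_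
  rw [cartan_sup_rootSum, ← rootSum_union]
  have hsub : ψ.set i ⊆ roots 𝔱 := by
    rw [← (ψ.parabolic i).union_neg]; exact Set.subset_union_left
  have hnil : ∀ α, α ∈ ψ.nil i ↔ α ∈ ψ.set i ∧ -α ∉ ψ.set i := by
    intro α
    simp only [nil, levi, Set.mem_sdiff, Set.mem_inter_iff, Set.mem_neg]
    tauto
  have hlevi : ∀ α, α ∈ ψ.levi i ↔ α ∈ ψ.set i ∧ -α ∈ ψ.set i := fun α => Iff.rfl
  apply isCompl_rootSum
  · rw [Set.disjoint_left]
    rintro α (hα | hα) (hβ | hβ)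
    · rw [Set.mem_singleton_iff] at hα
      subst hα
      exact (hsub ((hnil _).1 hβ).1).1 (by simp)
    · rw [Set.mem_singleton_iff] at hα
      subst hα
      exact (hsub ((hnil _).1 hβ).1).1 rfl
    · have := ((hnil _).1 hβ).2
      rw [neg_neg] at this
      exact this ((hlevi _).1 hα).1
    · exact ((hnil _).1 hβ).2 ((hlevi _).1 hα).2
  · rintro α (hα | hα)
    · exact Or.inl (Or.inl hα)
    · rw [← (ψ.parabolic i).union_neg] at hα
      by_cases h1 : α ∈ ψ.set i
      · by_cases h2 : -α ∈ ψ.set i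
        · exact Or.inl (Or.inr ⟨h1, h2⟩)
        · exact Or.inr (Or.inr ((hnil _).2 ⟨h1, h2⟩))
      · refine Or.inr (Or.inl ((hnil _).2 ⟨hα.resolve_left h1, ?_⟩))
        rwa [neg_neg]

/-- The projection `π_φ` onto `𝔩_φ` along `𝔲^-_ψ ⊕ 𝔲^+_ψ`. -/
noncomputable def leviProj : Tcla 𝔤 r →ₗ[ℂ] ψ.leviAlgebra r :=
  Submodule.projectionOnto (ψ.leviAlgebra r).toSubmodule (ψ.uMinus r ⊔ ψ.uPlus r)
    (ψ.isCompl_levi r)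

attribute [local instance] LieRing.ofAssociativeRing

variable {r}

/-- The restriction to `𝔩_φ` of a character of `𝔭_ψ`. -/
def restrictLevi (χ : LieAlgebra.LieCharacter ℂ (ψ.singularityAlgebra r)) :
    LieAlgebra.LieCharacter ℂ (ψ.leviAlgebra r) :=
  χ.comp (LieSubalgebra.inclusion (ψ.levi_le r))

/-- The pairing `(Y, Y') ↦ ⟨χ, π_φ [Y, Y']⟩` between `𝔲^+_ψ` and `𝔲^-_ψ`. -/
noncomputable def pairing (χ : LieAlgebra.LieCharacter ℂ (ψ.leviAlgebra r)) :
    ψ.uPlus r →ₗ[ℂ] ψ.uMinus r →ₗ[ℂ] ℂ :=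
  LinearMap.mk₂ ℂ (fun Y Y' => χ (ψ.leviProj r ⁅(Y : Tcla 𝔤 r), (Y' : Tcla 𝔤 r)⁆))
    (by simp) (by simp) (by simp) (by simp)

/-- A character of `𝔩_φ` is nonsingular if it extends by zero to a character of `𝔭_ψ` and the
associated pairing is nondegenerate. -/
def IsNonsingular (χ : LieAlgebra.LieCharacter ℂ (ψ.leviAlgebra r)) : Prop :=
  (∃ χ' : LieAlgebra.LieCharacter ℂ (ψ.singularityAlgebra r),
    ψ.restrictLevi χ' = χ ∧ ∀ Y : ψ.singularityAlgebra r, (Y : Tcla 𝔤 r) ∈ ψ.uPlus r → χ' Y = 0) ∧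
  (ψ.pairing χ).Nondegenerate

/-- The covector `(λ_0, …, λ_{r-1})` of a character `χ` of `𝔭_ψ`: `⟨λ_i, X⟩ = χ(X ε^i)`. -/
def covector (χ : LieAlgebra.LieCharacter ℂ (ψ.singularityAlgebra r)) :
    Fin r → Module.Dual ℂ 𝔱 := fun i =>
  { toFun := fun X => χ ⟨mono i (X : 𝔤),
      mono_mem_graded (V := fun i => 𝔱.toSubmodule ⊔ rootSum 𝔱 (ψ.set i))
        (Submodule.mem_sup_left X.2)⟩
    map_add' := fun X Y => by
      rw [← map_add]
      congr 1
      ext1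
      simp
    map_smul' := fun c X => by
      rw [RingHom.id_apply, ← map_smul]
      congr 1
      ext1
      simp }

/-- The pairing attached to `χ` is the restriction to `𝔲^+_ψ ⊗ 𝔲^-_ψ` of the value at `f` of the
KKS form of the coadjoint orbit of `f`: the space `𝔲^+_ψ ⊕ 𝔲^-_ψ` is a subspace of the tangent
space at `f`, through the quotient map, and the form on it restricts to the pairing. -/
def PairingIsKKS (χ : LieAlgebra.LieCharacter ℂ (ψ.leviAlgebra r))
    (f : Module.Dual ℂ (Tcla 𝔤 r)) : Prop :=
  Function.Injective (fun Y : ψ.uPlus r × ψ.uMinus r =>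
    (Submodule.Quotient.mk ((Y.1 : Tcla 𝔤 r) + (Y.2 : Tcla 𝔤 r)) : OrbitTangent f)) ∧
  ∀ (Y : ψ.uPlus r) (Y' : ψ.uMinus r), ψ.pairing χ Y Y' =
    kksForm f (Submodule.Quotient.mk (Y : Tcla 𝔤 r)) (Submodule.Quotient.mk (Y' : Tcla 𝔤 r))

end ParabolicFiltration

end WildKKS

/-! Let f be the covector λ extended by zero on the root spaces. Since χ kills commutators, it kills
every root space in `singularityAlgebra`, so χ is the restriction of f; and f vanishes on u⁺ and u⁻,
so χ ∘ π_φ computes f. Hence B(Y, Y') = f[Y, Y'] unconditionally (`extendByZero_covector_apply`,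
`pairing_apply`).

Two more facts hold for every χ. The stabiliser of f contains l_φ (`leviAlgebra_le_stabiliser`), and
u⁺ and u⁻ are isotropic for f[·,·], because two roots taken from the sets ν_i never cancel
(`add_ne_zero_of_mem_nil`). Therefore nondegeneracy of B, injectivity of u⁺ ⊕ u⁻ into the orbit
tangent space, and equality of l_φ with the stabiliser each say that the stabiliser meets u⁻ ⊕ u⁺
trivially. Nonsingularity adds nothing to nondegeneracy, as χ is itself the required extension.

The wild stratum is matched with the stabiliser one root at a time. For α ∈ φ_{d+1} ∖ φ_d, the forms
λ_k with k > d vanish on [g_α, g_{-α}], so everything depends on λ_d(α^∨): if it is nonzero, no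
element of the stabiliser has an α-component in a degree ≤ d; if it is zero, g_α ε^d lies in the
stabiliser but not in l_φ. This needs root spaces to be lines, coroots to exist, and a coroot to
determine its root. All three are obtained for reductive algebras by passing to the quotient by the
centre, which has trivial radical. -/

namespace LieAlgebra

/-! ### Surjections whose kernel is the centre. -/

section SurjectiveCentralKernel

open LieModule Module

variable {K L Q : Type*} [Field K] [CharZero K] [IsAlgClosed K]
  [LieRing L] [LieAlgebra K L] [FiniteDimensional K L]
  [LieRing Q] [LieAlgebra K Q] [FiniteDimensional K Q]
  {f : L →ₗ⁅K⁆ Q}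

theorem derivedSeriesOfIdeal_comap_le (J : LieIdeal K Q) (k : ℕ) :
    derivedSeriesOfIdeal K L k (J.comap f) ≤ (derivedSeriesOfIdeal K Q k J).comap f := by
  induction k with
  | zero => simp
  | succ k ih =>
    rw [derivedSeriesOfIdeal_succ, derivedSeriesOfIdeal_succ]
    exact (LieSubmodule.mono_lie ih ih).trans (LieIdeal.comap_bracket_le _)

/-- The quotient of a reductive Lie algebra by its centre has trivial radical. -/
theorem hasTrivialRadical_of_ker_eq_center [HasCentralRadical K L] (hf : Function.Surjective f)
    (hker : f.ker = center K L) : HasTrivialRadical K Q := by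
  refine ⟨?_⟩
  set I := (radical K Q).comap f
  have hsol : IsSolvable I := by
    obtain ⟨k, hk⟩ := IsSolvable.solvable K (radical K Q)
    rw [LieIdeal.derivedSeries_eq_bot_iff] at hk
    -- The k-th derived term of the preimage lies in the kernel, which is central, so one further
    -- bracket kills it.
    refine IsSolvable.mk (R := K) (k := k + 1) ((LieIdeal.derivedSeries_eq_bot_iff I (k + 1)).2 ?_)
    have h1 := derivedSeriesOfIdeal_comap_le (f := f) (radical K Q) k
    rw [hk] at h1
    have h2 : derivedSeriesOfIdeal K L k I ≤ center K L := hker ▸ h1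
    rw [derivedSeriesOfIdeal_succ, LieSubmodule.lie_eq_bot_iff]
    exact fun x _ m hm => h2 hm x
  have hle : I ≤ f.ker := by
    rw [hker, ← radical_eq_center]
    exact (LieIdeal.solvable_iff_le_radical K L I).1 hsol
  rw [eq_bot_iff]
  intro y hy
  obtain ⟨x, rfl⟩ := hf y
  have : x ∈ f.ker := hle (LieIdeal.mem_comap.2 hy)
  simpa using this

variable (H : LieSubalgebra K L) [H.IsCartanSubalgebra]

theorem center_le_of_isCartanSubalgebra {z : L} (hz : z ∈ center K L) : z ∈ H := by
  rw [← LieSubalgebra.IsCartanSubalgebra.self_normalizing (H := H),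
    LieSubalgebra.mem_normalizer_iff']
  intro y _
  rw [hz y]
  exact H.zero_mem

/-- The normaliser of the image pulls back into the normaliser of `H`: the discrepancy lies in the
kernel, which is the centre and so is contained in `H`. -/
theorem isCartanSubalgebra_map (hf : Function.Surjective f) (hker : f.ker = center K L) :
    (H.map f).IsCartanSubalgebra where
  nilpotent := by
    let g : H →ₗ⁅K⁆ H.map f :=
      { toFun := fun x => ⟨f x, x, x.2, rfl⟩
        map_add' := fun x y => by ext; simp
        map_smul' := fun c x => by ext; simp
        map_lie' := fun {x y} => by ext; simp }
    have hg : Function.Surjective g := by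
      rintro ⟨_, x, hx, rfl⟩
      exact ⟨⟨x, hx⟩, rfl⟩
    exact hg.lieAlgebra_isNilpotent
  self_normalizing := by
    refine le_antisymm (fun y hy => ?_) (LieSubalgebra.le_normalizer _)
    obtain ⟨x, rfl⟩ := hf y
    refine ⟨x, ?_, rfl⟩
    have : x ∈ H.normalizer := by
      rw [LieSubalgebra.mem_normalizer_iff]
      intro z hz
      obtain ⟨w, hw, hwz⟩ := (LieSubalgebra.mem_normalizer_iff _ _).1 hy (f z) ⟨z, hz, rfl⟩
      have h0 : ⁅x, z⁆ - w ∈ center K L := by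
        rw [← hker, LieHom.mem_ker, map_sub, LieHom.map_lie, ← hwz]
        exact sub_self _
      have := H.add_mem (center_le_of_isCartanSubalgebra H h0) hw
      rwa [sub_add_cancel] at this
    rwa [LieSubalgebra.IsCartanSubalgebra.self_normalizing] at this

variable {H}

theorem exists_mem_ne_zero_of_rootSpace_ne_bot {α : H → K} (hne : rootSpace H α ≠ ⊥) :
    ∃ x ∈ rootSpace H α, x ≠ 0 := by
  by_contra! h
  exact hne ((LieSubmodule.eq_bot_iff _).2 h)

theorem map_mem_rootSpace [LieRing.IsNilpotent (H.map f)] {α : H → K} {β : H.map f → K}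
    (h : ∀ x : H, β ⟨f x, x, x.2, rfl⟩ = α x)
    {x : L} (hx : x ∈ rootSpace H α) : f x ∈ rootSpace (H.map f) β := by
  rw [mem_genWeightSpace] at hx ⊢
  rintro ⟨_, t, ht, rfl⟩
  obtain ⟨k, hk⟩ := hx ⟨t, ht⟩
  refine ⟨k, ?_⟩
  have key : ∀ (k : ℕ) (y : L),
      ((toEnd K (H.map f) Q ⟨f t, t, ht, rfl⟩ - β ⟨f t, t, ht, rfl⟩ • 1) ^ k) (f y) =
        f (((toEnd K H L ⟨t, ht⟩ - α ⟨t, ht⟩ • 1) ^ k) y) := by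
    intro k
    induction k with
    | zero => simp
    | succ k ih =>
      intro y
      rw [pow_succ, pow_succ, Module.End.mul_apply, Module.End.mul_apply, ← ih]
      congr 1
      simp [h ⟨t, ht⟩]
  have := key k x
  rw [hk, map_zero] at this
  exact this

theorem map_mem_corootSpace [(H.map f).IsCartanSubalgebra] {α : H → K} {β : H.map f → K}
    (h : ∀ x : H, β ⟨f x, x, x.2, rfl⟩ = α x)
    {x : H} (hx : x ∈ corootSpace α) :
    (⟨f x, x, x.2, rfl⟩ : H.map f) ∈ corootSpace β := by
  rw [mem_corootSpace] at hx ⊢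
  have := Submodule.mem_map_of_mem (f := (f : L →ₗ[K] Q)) hx
  rw [Submodule.map_span] at this
  refine Submodule.span_mono ?_ this
  rintro _ ⟨_, ⟨y, hy, z, hz, rfl⟩, rfl⟩
  refine ⟨f y, map_mem_rootSpace h hy, f z, map_mem_rootSpace (α := -α) ?_ hz, ?_⟩
  · intro x
    simp [h x]
  · exact (f.map_lie y z).symm

/-- A central vector also has weight zero, and generalised weight spaces of distinct weights are
disjoint. Consequently `f` is injective on each root space with nonzero root. -/
theorem eq_zero_of_mem_center_of_mem_rootSpace {α : H → K} (hα : α ≠ 0) {x : L}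
    (hx : x ∈ rootSpace H α) (hc : x ∈ center K L) : x = 0 := by
  have h0 : x ∈ rootSpace H (0 : H → K) := by
    rw [mem_genWeightSpace]
    intro t
    refine ⟨1, ?_⟩
    simpa using hc t
  exact LieSubmodule.mem_bot x |>.1
    ((disjoint_genWeightSpace K H L hα).le_bot ⟨hx, h0⟩)

/-- Here ad z = 0, so the nilpotency condition reads (-α z)^k x = 0 for a nonzero x. -/
theorem apply_eq_zero_of_mem_center {α : H → K} (hne : rootSpace H α ≠ ⊥) {z : H}
    (hz : (z : L) ∈ center K L) : α z = 0 := by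
  obtain ⟨x, hx, hx0⟩ := exists_mem_ne_zero_of_rootSpace_ne_bot hne
  obtain ⟨k, hk⟩ := (mem_genWeightSpace L α x).1 hx z
  have h0 : toEnd K H L z = 0 := by
    ext y
    have := hz y
    rw [← lie_skew, neg_eq_zero] at this
    simpa using this
  rw [h0, zero_sub, ← neg_smul, smul_pow, one_pow, LinearMap.smul_apply, Module.End.one_apply,
    smul_eq_zero] at hk
  simpa using eq_zero_of_pow_eq_zero (hk.resolve_right hx0)

/-- A root descends to the quotient by the centre. -/
theorem exists_weight_map [LieRing.IsNilpotent (H.map f)] (hker : f.ker = center K L)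
    {α : Dual K H} (hα : α ≠ 0) (hne : rootSpace H α ≠ ⊥) :
    ∃ w : Weight K (H.map f) Q, w.IsNonZero ∧ ∀ x : H, w ⟨f x, x, x.2, rfl⟩ = α x := by
  let g : H →ₗ[K] H.map f :=
    { toFun := fun x => ⟨f x, x, x.2, rfl⟩
      map_add' := fun x y => by ext; simp
      map_smul' := fun c x => by ext; simp }
  have hg : Function.Surjective g := by
    rintro ⟨_, x, hx, rfl⟩
    exact ⟨⟨x, hx⟩, rfl⟩
  -- The kernel of `g` consists of central elements, on which α vanishes, so α factors through `g`.
  have hmem : α ∈ LinearMap.range g.dualMap := by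
    rw [LinearMap.range_dualMap_eq_dualAnnihilator_ker_of_surjective g hg,
      Submodule.mem_dualAnnihilator]
    intro z hz
    refine apply_eq_zero_of_mem_center hne ?_
    rw [← hker, LieHom.mem_ker]
    exact congrArg Subtype.val (LinearMap.mem_ker.1 hz)
  obtain ⟨β, hβ⟩ := hmem
  have hβα : ∀ x : H, β ⟨f x, x, x.2, rfl⟩ = α x := fun x => LinearMap.congr_fun hβ x
  obtain ⟨x, hx, hx0⟩ := exists_mem_ne_zero_of_rootSpace_ne_bot hne
  refine ⟨⟨β, fun h => hx0 ?_⟩,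
    fun h0 => hα ?_, hβα⟩
  · exact eq_zero_of_mem_center_of_mem_rootSpace (fun h => hα (DFunLike.coe_injective h)) hx
      (hker ▸ LieHom.mem_ker.2 ((LieSubmodule.eq_bot_iff _).1 h _ (map_mem_rootSpace hβα hx)))
  · ext x
    rw [← hβα x]
    exact congrFun h0 _

end SurjectiveCentralKernel

/-! ### Root spaces and coroots of a reductive Lie algebra. -/

section Reductive

open LieModule Module

variable {K L : Type*} [Field K] [CharZero K] [IsAlgClosed K]
  [LieRing L] [LieAlgebra K L] [FiniteDimensional K L]

theorem exists_surjective_ker_eq_center :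
    ∃ f : L →ₗ⁅K⁆ L ⧸ center K L, Function.Surjective f ∧ f.ker = center K L := by
  refine ⟨{ LieSubmodule.Quotient.mk' (center K L) with map_lie' := fun {x y} => rfl },
    LieSubmodule.Quotient.surjective_mk' _, ?_⟩
  ext x
  rw [LieHom.mem_ker]
  exact LieSubmodule.Quotient.mk_eq_zero (N := center K L)

variable [HasCentralRadical K L] {H : LieSubalgebra K L} [H.IsCartanSubalgebra]

/-- The root spaces of a reductive Lie algebra are lines. -/
theorem exists_smul_eq_of_mem_rootSpace {α : Dual K H} (hα : α ≠ 0) {x y : L}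
    (hx : x ∈ rootSpace H α) (hx0 : x ≠ 0) (hy : y ∈ rootSpace H α) : ∃ c : K, c • x = y := by
  obtain ⟨f, hf, hker⟩ := exists_surjective_ker_eq_center (K := K) (L := L)
  have := hasTrivialRadical_of_ker_eq_center hf hker
  have := isCartanSubalgebra_map H hf hker
  obtain ⟨w, hw, hwα⟩ := exists_weight_map hker hα fun h =>
    hx0 ((LieSubmodule.eq_bot_iff _).1 h x hx)
  have h1 := IsKilling.finrank_rootSpace_eq_one w hw
  have hα' : (α : H → K) ≠ 0 := fun h => hα (DFunLike.coe_injective h)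
  -- Injectivity of `f` on the root space carries proportionality back from the quotient.
  have hinj : ∀ z ∈ rootSpace H α, f z = 0 → z = 0 := fun z hz h =>
    eq_zero_of_mem_center_of_mem_rootSpace hα' hz (hker ▸ LieHom.mem_ker.2 h)
  obtain ⟨c, hc⟩ := (finrank_eq_one_iff_of_nonzero'
    (⟨f x, map_mem_rootSpace hwα hx⟩ : rootSpace (H.map f) w)
    (fun h => hx0 (hinj x hx (congrArg Subtype.val h)))).1 h1 ⟨f y, map_mem_rootSpace hwα hy⟩
  refine ⟨c, ?_⟩
  rw [← sub_eq_zero]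
  refine hinj _ (sub_mem (SMulMemClass.smul_mem c hx) hy) ?_
  rw [map_sub, map_smul, sub_eq_zero]
  exact congrArg Subtype.val hc

/-- Existence of coroots in a reductive Lie algebra. -/
theorem exists_mem_corootSpace_apply_eq_two {α : Dual K H} (hα : α ≠ 0)
    (hne : rootSpace H α ≠ ⊥) : ∃ h ∈ corootSpace (α : H → K), α h = 2 := by
  obtain ⟨f, hf, hker⟩ := exists_surjective_ker_eq_center (K := K) (L := L)
  have := hasTrivialRadical_of_ker_eq_center hf hker
  have := isCartanSubalgebra_map H hf hker
  obtain ⟨w, hw, hwα⟩ := exists_weight_map hker hα hne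
  have hα' : (α : H → K) ≠ 0 := fun h => hα (DFunLike.coe_injective h)
  -- A genuine eigenvector is chosen, not merely a generalised one, for the invariance computation
  -- `h3`.
  obtain ⟨e, he0, he⟩ := exists_forall_lie_eq_smul K H L ⟨α, hne⟩
  replace he : ∀ x : H, ⁅x, e⁆ = α x • e := he
  have heα : e ∈ rootSpace H α :=
    weightSpace_le_genWeightSpace L α ((mem_weightSpace α e).2 he)
  -- Otherwise e would be in the radical of the Killing form, hence in the centre, hence zero.
  have hpair : ∃ y ∈ rootSpace H (-α : H → K), killingForm K L e y ≠ 0 := by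
    by_contra! hcon
    have h1 := mem_ker_killingForm_of_mem_rootSpace_of_forall_rootSpace_neg K L H heα hcon
    refine he0 (eq_zero_of_mem_center_of_mem_rootSpace hα' heα ?_)
    rw [← radical_eq_center]
    refine killingCompl_top_le_radical K L ((LieIdeal.mem_killingCompl K L ⊤).2 fun y _ => ?_)
    rw [LieModule.traceForm_comm]
    exact LinearMap.congr_fun (LinearMap.mem_ker.1 h1) y
  obtain ⟨y, hy, hey⟩ := hpair
  have hH : ⁅e, y⁆ ∈ H := by
    have := lie_mem_genWeightSpace_of_mem_genWeightSpace heα hy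
    rw [add_neg_cancel] at this
    change ⁅e, y⁆ ∈ rootSpace H (0 : H → K) at this
    rwa [rootSpace_zero_eq] at this
  set t : H := ⟨⁅e, y⁆, hH⟩
  have ht : t ∈ corootSpace (α : H → K) :=
    mem_corootSpace (α := (α : H → K)) |>.2 (Submodule.subset_span ⟨e, heα, y, hy, rfl⟩)
  -- If α t = 0, then t dies in the quotient and is central, so the Killing form vanishes against
  -- [e, y]. Invariance gives κ(x, [e, y]) = α(x) κ(e, y), which is nonzero for some x.
  have hαt : α t ≠ 0 := by
    intro h0
    have h1 := IsKilling.eq_zero_of_apply_eq_zero_of_mem_corootSpace _ (w : H.map f → K)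
      ((hwα t).trans h0) (map_mem_corootSpace hwα ht)
    have h2 : ⁅e, y⁆ ∈ center K L := hker ▸ LieHom.mem_ker.2 (congrArg Subtype.val h1)
    obtain ⟨x, hx⟩ := DFunLike.ne_iff.1 hα
    have h3 : killingForm K L x ⁅e, y⁆ = α x * killingForm K L e y := by
      have h4 := LieModule.traceForm_apply_lie_apply K L L (x : L) e y
      have h5 : ⁅(x : L), e⁆ = α x • e := he x
      rw [killingForm, ← h4, h5, map_smul, LinearMap.smul_apply, smul_eq_mul]
    have h6 : killingForm K L x ⁅e, y⁆ = 0 := by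
      have h7 : ad K L ⁅e, y⁆ = 0 := by
        ext z
        have := h2 z
        rw [← lie_skew, neg_eq_zero] at this
        exact this
      rw [killingForm_apply_apply, h7, LinearMap.comp_zero, map_zero]
    rw [h6] at h3
    exact mul_ne_zero hx hey h3.symm
  refine ⟨(2 / α t) • t, SMulMemClass.smul_mem _ ht, ?_⟩
  rw [map_smul, smul_eq_mul, div_mul_cancel₀ _ hαt]

/-- A root of a reductive Lie algebra is determined by its coroot. -/
theorem eq_of_mem_corootSpace_of_apply_eq_two {α β : Dual K H} (hα : α ≠ 0)
    (hαne : rootSpace H α ≠ ⊥) (hβ : β ≠ 0) (hβne : rootSpace H β ≠ ⊥) {h : H}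
    (hhα : h ∈ corootSpace (α : H → K)) (hhβ : h ∈ corootSpace (β : H → K))
    (hα2 : α h = 2) (hβ2 : β h = 2) : α = β := by
  obtain ⟨f, hf, hker⟩ := exists_surjective_ker_eq_center (K := K) (L := L)
  have := hasTrivialRadical_of_ker_eq_center hf hker
  have := isCartanSubalgebra_map H hf hker
  obtain ⟨v, hv, hvα⟩ := exists_weight_map hker hα hαne
  obtain ⟨w, hw, hwβ⟩ := exists_weight_map hker hβ hβne
  have h1 := IsKilling.eq_coroot_of_mem_corootSpace_of_two v (map_mem_corootSpace hvα hhα)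
    ((hvα h).trans hα2)
  have h2 := IsKilling.eq_coroot_of_mem_corootSpace_of_two w (map_mem_corootSpace hwβ hhβ)
    ((hwβ h).trans hβ2)
  have h3 : v = w := by simpa using h1.symm.trans h2
  subst h3
  ext x
  rw [← hvα, ← hwβ]

end Reductive

end LieAlgebra

namespace WildKKS

/-! ### Monomials in the truncated current algebra. -/

section Tcla

variable {𝔤 : Type*} [LieRing 𝔤] [LieAlgebra ℂ 𝔤] {r : ℕ}

@[simp] theorem mono_same (i : Fin r) (x : 𝔤) : mono i x i = x :=
  Pi.single_eq_same (M := fun _ : Fin r => 𝔤) i x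

theorem mono_of_ne {i j : Fin r} (h : j ≠ i) (x : 𝔤) : mono i x j = 0 :=
  Pi.single_eq_of_ne (M := fun _ : Fin r => 𝔤) h x

theorem sum_mono (Y : Tcla 𝔤 r) : ∑ i, mono i (Y i) = Y :=
  Finset.univ_sum_single (M := fun _ : Fin r => 𝔤) Y

end Tcla

section Coadjoint

theorem mem_coadjointStabiliser_iff {V : Type*} [LieRing V] [LieAlgebra ℂ V]
    {f : Module.Dual ℂ V} {Y : V} : Y ∈ coadjointStabiliser f ↔ ∀ Z, f ⁅Y, Z⁆ = 0 := by
  refine ⟨fun h => apply_lie_of_mem_stabiliser h, fun h => ?_⟩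
  change ⁅Y, f⁆ = 0
  ext Z
  simpa using h Z

end Coadjoint

/-! ### Root components, the projection to the Cartan subalgebra, and covectors extended by zero. -/

section Roots

variable {𝔤 : Type*} [LieRing 𝔤] [LieAlgebra ℂ 𝔤] [FiniteDimensional ℂ 𝔤]
  {𝔱 : LieSubalgebra ℂ 𝔤} [𝔱.IsCartanSubalgebra]

theorem rootSpace_le_rootSum {S : Set (Module.Dual ℂ 𝔱)} {α : Module.Dual ℂ 𝔱} (hα : α ∈ S) :
    (LieAlgebra.rootSpace 𝔱 α).toSubmodule ≤ rootSum 𝔱 S :=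
  le_biSup (fun α : Module.Dual ℂ 𝔱 => (LieAlgebra.rootSpace 𝔱 α).toSubmodule) hα

theorem disjoint_rootSum {A B : Set (Module.Dual ℂ 𝔱)} (h : Disjoint A B) :
    Disjoint (rootSum 𝔱 A) (rootSum 𝔱 B) := by
  have hi := LieModule.iSupIndep_genWeightSpace ℂ 𝔱 𝔤
  rw [← LieSubmodule.iSupIndep_toSubmodule] at hi
  exact (hi.comp (f := fun α : Module.Dual ℂ 𝔱 => (α : 𝔱 → ℂ))
    DFunLike.coe_injective).disjoint_biSup_biSup h

theorem mem_of_mem_rootSpace_zero {x : 𝔤}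
    (hx : x ∈ LieAlgebra.rootSpace 𝔱 ((0 : Module.Dual ℂ 𝔱) : 𝔱 → ℂ)) : x ∈ 𝔱 := by
  have h := LieAlgebra.rootSpace_zero_eq ℂ 𝔤 𝔱
  change x ∈ LieAlgebra.rootSpace 𝔱 (0 : 𝔱 → ℂ) at hx
  rwa [h] at hx

theorem rootSum_univ : rootSum 𝔱 (Set.univ) = ⊤ := by
  have h := isCompl_rootSum (𝔱 := 𝔱) (A := Set.univ) (B := ∅) (by simp) (by simp)
  have h0 : rootSum 𝔱 ∅ = ⊥ := by simp [rootSum]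
  simpa [h0] using h.sup_eq_top

/-- Every element is a finite sum of elements of the root spaces. -/
theorem exists_finsupp_rootSpace (𝔱 : LieSubalgebra ℂ 𝔤) [𝔱.IsCartanSubalgebra] (x : 𝔤) :
    ∃ c : Module.Dual ℂ 𝔱 →₀ 𝔤, (∀ α : Module.Dual ℂ 𝔱, c α ∈ LieAlgebra.rootSpace 𝔱 α) ∧
      (c.sum fun _ y => y) = x := by
  have hx : x ∈ rootSum 𝔱 Set.univ := by rw [rootSum_univ]; trivial
  simp only [rootSum, Set.mem_univ, iSup_pos] at hx
  exact (Submodule.mem_iSup_iff_exists_finsupp _ _).1 hx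

theorem cartanProj_of_mem {x : 𝔤} (hx : x ∈ 𝔱) : cartanProj (𝔱 := 𝔱) x = ⟨x, hx⟩ :=
  Submodule.projectionOnto_apply_left _ (⟨x, hx⟩ : 𝔱.toSubmodule)

theorem cartanProj_eq_zero {x : 𝔤} (hx : x ∈ rootSum 𝔱 (roots 𝔱)) :
    cartanProj (𝔱 := 𝔱) x = 0 :=
  (Submodule.projectionOnto_apply_eq_zero_iff _).2 hx

theorem cartanProj_eq_zero_of_mem_rootSpace {α : Module.Dual ℂ 𝔱} (hα : α ≠ 0) {x : 𝔤}
    (hx : x ∈ LieAlgebra.rootSpace 𝔱 α) : cartanProj (𝔱 := 𝔱) x = 0 := by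
  by_cases hb : LieAlgebra.rootSpace 𝔱 (α : 𝔱 → ℂ) = ⊥
  · rw [hb, LieSubmodule.mem_bot] at hx
    rw [hx, map_zero]
  · exact cartanProj_eq_zero (rootSpace_le_rootSum (S := roots 𝔱) ⟨hα, hb⟩ hx)

theorem cartanProj_lie_eq_zero {α β : Module.Dual ℂ 𝔱} (h : α + β ≠ 0) {x y : 𝔤}
    (hx : x ∈ LieAlgebra.rootSpace 𝔱 α) (hy : y ∈ LieAlgebra.rootSpace 𝔱 β) :
    cartanProj (𝔱 := 𝔱) ⁅x, y⁆ = 0 :=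
  cartanProj_eq_zero_of_mem_rootSpace h
    (LieAlgebra.lie_mem_genWeightSpace_of_mem_genWeightSpace hx hy)

/-- Under the bracket with an element of `𝔤_{-α}`, followed by the projection to the Cartan
subalgebra, only the component in `𝔤_α` matters. -/
theorem cartanProj_lie_sum {c : Module.Dual ℂ 𝔱 →₀ 𝔤}
    (hc : ∀ α : Module.Dual ℂ 𝔱, c α ∈ LieAlgebra.rootSpace 𝔱 α) {α : Module.Dual ℂ 𝔱} {z : 𝔤}
    (hz : z ∈ LieAlgebra.rootSpace 𝔱 ((-α : Module.Dual ℂ 𝔱) : 𝔱 → ℂ)) :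
    cartanProj (𝔱 := 𝔱) ⁅c.sum fun _ y => y, z⁆ = cartanProj (𝔱 := 𝔱) ⁅c α, z⁆ := by
  classical
  rw [Finsupp.sum, sum_lie, map_sum, Finset.sum_eq_single α]
  · intro β _ hβ
    exact cartanProj_lie_eq_zero (by rwa [← sub_eq_add_neg, sub_ne_zero]) (hc β) hz
  · intro h
    rw [Finsupp.notMem_support_iff.1 h, zero_lie, map_zero]

theorem extendByZero_apply {r : ℕ} (lam : Fin r → Module.Dual ℂ 𝔱) (Y : Tcla 𝔤 r) :
    extendByZero lam Y = ∑ i, lam i (cartanProj (𝔱 := 𝔱) (Y i)) := by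
  simp [extendByZero]
  rfl

theorem extendByZero_mono {r : ℕ} (lam : Fin r → Module.Dual ℂ 𝔱) (i : Fin r) (x : 𝔤) :
    extendByZero lam (mono i x) = lam i (cartanProj (𝔱 := 𝔱) x) := by
  rw [extendByZero_apply, Finset.sum_eq_single i, mono_same]
  · intro j _ hj
    rw [mono_of_ne hj, map_zero, map_zero]
  · simp

theorem extendByZero_lie {r : ℕ} (lam : Fin r → Module.Dual ℂ 𝔱) (Y Z : Tcla 𝔤 r) :
    extendByZero lam ⁅Y, Z⁆ = ∑ i : Fin r, ∑ j : Fin r, ∑ k : Fin r,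
      if (i : ℕ) + j = k then lam k (cartanProj (𝔱 := 𝔱) ⁅Y i, Z j⁆) else 0 := by
  rw [extendByZero_apply]
  simp only [Tcla.lie_apply, map_sum]
  rw [Finset.sum_comm]
  refine Finset.sum_congr rfl fun i _ => ?_
  rw [Finset.sum_comm]
  refine Finset.sum_congr rfl fun j _ => Finset.sum_congr rfl fun k _ => ?_
  split_ifs <;> simp

theorem extendByZero_lie_mono {r : ℕ} (lam : Fin r → Module.Dual ℂ 𝔱) (Y : Tcla 𝔤 r)
    (j : Fin r) (z : 𝔤) :
    extendByZero lam ⁅Y, mono j z⁆ = ∑ i : Fin r, ∑ k : Fin r,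
      if (i : ℕ) + j = k then lam k (cartanProj (𝔱 := 𝔱) ⁅Y i, z⁆) else 0 := by
  rw [extendByZero_lie]
  refine Finset.sum_congr rfl fun i _ => ?_
  rw [Finset.sum_eq_single j]
  · simp only [mono_same]
  · intro l _ hl
    refine Finset.sum_eq_zero fun k _ => ?_
    rw [mono_of_ne hl]
    simp
  · simp

theorem extendByZero_lie_mono_mono {r : ℕ} (lam : Fin r → Module.Dual ℂ 𝔱) {i j k : Fin r}
    (h : (i : ℕ) + j = k) (x y : 𝔤) :
    extendByZero lam ⁅mono i x, mono j y⁆ = lam k (cartanProj (𝔱 := 𝔱) ⁅x, y⁆) := by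
  rw [extendByZero_lie_mono, Finset.sum_eq_single i, Finset.sum_eq_single k, if_pos h, mono_same]
  · intro l _ hl
    exact if_neg fun h' => hl (Fin.ext (h'.symm.trans h))
  · simp
  · intro l _ hl
    refine Finset.sum_eq_zero fun k _ => ?_
    rw [mono_of_ne hl]
    simp
  · simp

/-- A linear form that vanishes on `[t, 𝔤_α]` for all `t` vanishes on `𝔤_α`, if `α ≠ 0`. -/
theorem apply_eq_zero_of_mem_rootSpace {α : Module.Dual ℂ 𝔱} (hα : α ≠ 0) {g : 𝔤 →ₗ[ℂ] ℂ}
    (hg : ∀ t : 𝔱, ∀ x ∈ LieAlgebra.rootSpace 𝔱 α, g ⁅(t : 𝔤), x⁆ = 0) {x : 𝔤}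
    (hx : x ∈ LieAlgebra.rootSpace 𝔱 α) : g x = 0 := by
  obtain ⟨t, ht⟩ := DFunLike.ne_iff.1 hα
  obtain ⟨k, hk⟩ := (LieModule.mem_genWeightSpace 𝔤 α x).1 hx t
  -- Because `g` kills brackets with t, applying ad t - α t before `g` amounts to multiplying by -α
  -- t. This scalar is nonzero, while a power of the operator kills x.
  have key : ∀ (k : ℕ), ∀ y ∈ LieAlgebra.rootSpace 𝔱 α,
      g (((LieModule.toEnd ℂ 𝔱 𝔤 t - α t • 1) ^ k) y) = (-α t) ^ k * g y := by
    intro k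
    induction k with
    | zero => simp
    | succ k ih =>
      intro y hy
      have h1 : (LieModule.toEnd ℂ 𝔱 𝔤 t - α t • 1) y = ⁅(t : 𝔤), y⁆ - α t • y := rfl
      have h2 : ⁅(t : 𝔤), y⁆ ∈ LieAlgebra.rootSpace 𝔱 α :=
        (LieAlgebra.rootSpace 𝔱 α).lie_mem (x := t) hy
      rw [pow_succ, Module.End.mul_apply, h1,
        ih _ (sub_mem h2 (SMulMemClass.smul_mem (α t) hy)), map_sub, hg t y hy, map_smul,
        smul_eq_mul]
      ring
  have := key k x hx
  rw [hk, map_zero] at this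
  exact (mul_eq_zero.1 this.symm).resolve_left (pow_ne_zero _ (neg_ne_zero.2 ht))

end Roots

/-! ### Characters of the singularity algebra and the stabiliser of their covector. -/

namespace ParabolicFiltration

variable {𝔤 : Type*} [LieRing 𝔤] [LieAlgebra ℂ 𝔤] [FiniteDimensional ℂ 𝔤]
  {𝔱 : LieSubalgebra ℂ 𝔤} [𝔱.IsCartanSubalgebra] (ψ : ParabolicFiltration 𝔱) {r : ℕ}

theorem set_subset_roots (i : ℕ) : ψ.set i ⊆ roots 𝔱 := by
  rw [← (ψ.parabolic i).union_neg]
  exact Set.subset_union_left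

theorem nil_subset_roots (i : ℕ) : ψ.nil i ⊆ roots 𝔱 :=
  Set.sdiff_subset.trans (ψ.set_subset_roots i)

theorem neg_nil_subset_roots (i : ℕ) : -ψ.nil i ⊆ roots 𝔱 := fun α hα => by
  simpa using ψ.neg_mem_roots (ψ.nil_subset_roots i hα)

/-- If β = -α, monotonicity puts both α and -α into the later of ψ_i and ψ_j, so one of the two
roots would lie in a Levi factor. This is the source of the isotropy of u⁺ and u⁻. -/
theorem add_ne_zero_of_mem_nil {i j : ℕ} {α β : Module.Dual ℂ 𝔱} (hα : α ∈ ψ.nil i)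
    (hβ : β ∈ ψ.nil j) : α + β ≠ 0 := by
  intro h
  obtain rfl : β = -α := (neg_eq_of_add_eq_zero_right h).symm
  have h1 : -α ∉ ψ.set i := fun h' => hα.2 ⟨hα.1, h'⟩
  have h2 : α ∉ ψ.set j := fun h' => hβ.2 ⟨hβ.1, by simpa using h'⟩
  rcases le_total i j with hij | hij
  · exact h2 (ψ.monotone_set hij hα.1)
  · exact h1 (ψ.monotone_set hij hβ.1)

theorem levi_eq_roots (hψ : ψ.set r = roots 𝔱) : ψ.levi r = roots 𝔱 := by
  rw [levi, hψ]
  exact Set.inter_eq_left.2 fun α hα => ψ.neg_mem_roots hα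

attribute [local instance] LieRing.ofAssociativeRing

section Character

variable (χ : LieAlgebra.LieCharacter ℂ (ψ.singularityAlgebra r))

theorem character_lie (X Y : ψ.singularityAlgebra r) : χ ⁅X, Y⁆ = 0 := by
  rw [LieHom.map_lie, LieRing.of_associative_ring_bracket, mul_comm, sub_self]

theorem mono_mem_singularityAlgebra {i : Fin r} {x : 𝔤}
    (hx : x ∈ 𝔱.toSubmodule ⊔ rootSum 𝔱 (ψ.set i)) : mono i x ∈ ψ.singularityAlgebra r :=
  mono_mem_graded (V := fun i => 𝔱.toSubmodule ⊔ rootSum 𝔱 (ψ.set i)) hx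

/-- A character of the singularity algebra vanishes on the root spaces, so that it is the
restriction of its covector. -/
theorem extendByZero_covector_apply (Y : ψ.singularityAlgebra r) :
    extendByZero (ψ.covector χ) (Y : Tcla 𝔤 r) = χ Y := by
  -- An arbitrary linear extension of χ, so that χ can be composed with `mono i` on all of 𝔤.
  obtain ⟨F, hF⟩ := LinearMap.exists_extend
    (p := (ψ.singularityAlgebra r).toSubmodule) (χ : ψ.singularityAlgebra r →ₗ[ℂ] ℂ)
  replace hF : ∀ (X : Tcla 𝔤 r) (hX : X ∈ ψ.singularityAlgebra r), F X = χ ⟨X, hX⟩ :=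
    fun X hX => LinearMap.congr_fun hF ⟨X, hX⟩
  have key : ∀ i : Fin r, 𝔱.toSubmodule ⊔ rootSum 𝔱 (ψ.set i) ≤
      LinearMap.eqLocus (F ∘ₗ mono i) (ψ.covector χ i ∘ₗ cartanProj (𝔱 := 𝔱)) := by
    intro i
    refine sup_le (fun x hx => ?_) (iSup₂_le fun α hα x hx => ?_)
    · rw [LinearMap.mem_eqLocus, LinearMap.comp_apply, LinearMap.comp_apply, cartanProj_of_mem hx,
        hF _ (ψ.mono_mem_singularityAlgebra (Submodule.mem_sup_left hx))]
      rfl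
    · have hα0 := (ψ.set_subset_roots i hα).1
      rw [LinearMap.mem_eqLocus, LinearMap.comp_apply (ψ.covector χ i),
        cartanProj_eq_zero_of_mem_rootSpace hα0 hx, map_zero]
      refine apply_eq_zero_of_mem_rootSpace hα0 (fun t y hy => ?_) hx
      have hr : 0 < r := i.pos
      -- Bracketing with t in degree 0 preserves the degree, so [t, g_α] ε^i consists of commutators
      -- in the singularity algebra.
      have h1 : ⁅mono ⟨0, hr⟩ (t : 𝔤), mono i y⁆ = mono i ⁅(t : 𝔤), y⁆ := by
        ext k
        rw [Tcla.lie_apply, Finset.sum_eq_single ⟨0, hr⟩, Finset.sum_eq_single i]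
        · rw [mono_same, mono_same]
          by_cases hk : k = i
          · subst hk
            simp
          · rw [mono_of_ne hk, if_neg]
            intro h
            exact hk (Fin.ext (by simpa using h.symm))
        · intro l _ hl
          rw [mono_of_ne hl]
          simp
        · simp
        · intro l _ hl
          rw [mono_of_ne hl]
          simp
        · simp
      have h2 : mono ⟨0, hr⟩ (t : 𝔤) ∈ ψ.singularityAlgebra r :=
        ψ.mono_mem_singularityAlgebra (Submodule.mem_sup_left t.2)
      have h3 : mono i y ∈ ψ.singularityAlgebra r :=
        ψ.mono_mem_singularityAlgebra (Submodule.mem_sup_right (rootSpace_le_rootSum hα hy))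
      rw [LinearMap.comp_apply, ← h1, hF _ (LieSubalgebra.lie_mem _ h2 h3)]
      exact ψ.character_lie χ ⟨_, h2⟩ ⟨_, h3⟩
  rw [← hF Y Y.2, ← sum_mono (Y : Tcla 𝔤 r), map_sum, map_sum]
  refine Finset.sum_congr rfl fun i _ => ?_
  rw [extendByZero_mono]
  exact (key i (Y.2 i)).symm

theorem extendByZero_covector_lie {X Y : Tcla 𝔤 r} (hX : X ∈ ψ.singularityAlgebra r)
    (hY : Y ∈ ψ.singularityAlgebra r) : extendByZero (ψ.covector χ) ⁅X, Y⁆ = 0 := by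
  rw [← ψ.character_lie χ ⟨X, hX⟩ ⟨Y, hY⟩, ← extendByZero_covector_apply]
  rfl

theorem extendByZero_eq_zero_of_mem {lam : Fin r → Module.Dual ℂ 𝔱} {Y : Tcla 𝔤 r}
    (hY : Y ∈ ψ.uMinus r ⊔ ψ.uPlus r) : extendByZero lam Y = 0 := by
  obtain ⟨A, hA, B, hB, rfl⟩ := Submodule.mem_sup.1 hY
  rw [extendByZero_apply]
  refine Finset.sum_eq_zero fun i _ => ?_
  rw [Tcla.add_apply, map_add,
    cartanProj_eq_zero (rootSum_mono (ψ.neg_nil_subset_roots i) (hA i)),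
    cartanProj_eq_zero (rootSum_mono (ψ.nil_subset_roots i) (hB i)), add_zero, map_zero]

/-- The extended covector does not see the part of Y in u⁻ ⊕ u⁺, and on l_φ it agrees with χ. -/
theorem restrictLevi_leviProj (Y : Tcla 𝔤 r) :
    ψ.restrictLevi χ (ψ.leviProj r Y) = extendByZero (ψ.covector χ) Y := by
  have h1 : ψ.restrictLevi χ (ψ.leviProj r Y) =
      extendByZero (ψ.covector χ) (ψ.leviProj r Y : Tcla 𝔤 r) :=
    (ψ.extendByZero_covector_apply χ ⟨_, ψ.levi_le r (ψ.leviProj r Y).2⟩).symm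
  have h2 : Y - (ψ.leviProj r Y : Tcla 𝔤 r) ∈ ψ.uMinus r ⊔ ψ.uPlus r := by
    rw [← Submodule.projectionOnto_apply_eq_zero_iff (ψ.isCompl_levi r)]
    change ψ.leviProj r _ = 0
    rw [map_sub, sub_eq_zero]
    exact (Submodule.projectionOnto_apply_left (ψ.isCompl_levi r) (ψ.leviProj r Y)).symm
  have h3 := extendByZero_eq_zero_of_mem ψ (lam := ψ.covector χ) h2
  rw [map_sub, sub_eq_zero] at h3
  rw [h1, h3]

theorem pairing_apply (Y : ψ.uPlus r) (Y' : ψ.uMinus r) :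
    ψ.pairing (ψ.restrictLevi χ) Y Y' =
      extendByZero (ψ.covector χ) ⁅(Y : Tcla 𝔤 r), (Y' : Tcla 𝔤 r)⁆ :=
  ψ.restrictLevi_leviProj χ _

/-- `λ_k` vanishes on `[𝔤_α, 𝔤_{-α}]` for `α ∈ φ_k` and for `α = 0`. -/
theorem covector_cartanProj_lie {k : Fin r} {α : Module.Dual ℂ 𝔱} (hα : α ∈ {0} ∪ ψ.levi k)
    {x y : 𝔤} (hx : x ∈ LieAlgebra.rootSpace 𝔱 α)
    (hy : y ∈ LieAlgebra.rootSpace 𝔱 ((-α : Module.Dual ℂ 𝔱) : 𝔱 → ℂ)) :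
    ψ.covector χ k (cartanProj (𝔱 := 𝔱) ⁅x, y⁆) = 0 := by
  have hr : 0 < r := k.pos
  rcases hα with rfl | hα
  · rw [neg_zero] at hy
    rw [← extendByZero_lie_mono_mono _ (i := ⟨0, hr⟩) (j := k) (Nat.zero_add _)]
    exact ψ.extendByZero_covector_lie χ
      (ψ.mono_mem_singularityAlgebra (Submodule.mem_sup_left (mem_of_mem_rootSpace_zero hx)))
      (ψ.mono_mem_singularityAlgebra (Submodule.mem_sup_left (mem_of_mem_rootSpace_zero hy)))
  · have h0 : α ∈ ψ.set 0 ∪ -ψ.set 0 := by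
      rw [(ψ.parabolic 0).union_neg]
      exact ψ.set_subset_roots k hα.1
    have hn : -α ∈ ψ.set k := hα.2
    rcases h0 with h0 | h0
    · rw [← extendByZero_lie_mono_mono _ (i := ⟨0, hr⟩) (j := k) (Nat.zero_add _)]
      exact ψ.extendByZero_covector_lie χ
        (ψ.mono_mem_singularityAlgebra (Submodule.mem_sup_right (rootSpace_le_rootSum h0 hx)))
        (ψ.mono_mem_singularityAlgebra (Submodule.mem_sup_right (rootSpace_le_rootSum hn hy)))
    · have h0' : -α ∈ ψ.set (⟨0, hr⟩ : Fin r) := h0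
      rw [← extendByZero_lie_mono_mono _ (i := k) (j := ⟨0, hr⟩) (Nat.add_zero _)]
      exact ψ.extendByZero_covector_lie χ
        (ψ.mono_mem_singularityAlgebra (Submodule.mem_sup_right (rootSpace_le_rootSum hα.1 hx)))
        (ψ.mono_mem_singularityAlgebra (Submodule.mem_sup_right (rootSpace_le_rootSum h0' hy)))

theorem covector_cartanProj_lie_of_mem {k : Fin r} {α : Module.Dual ℂ 𝔱}
    (hα : α ∈ {0} ∪ ψ.levi k) {x : 𝔤} (hx : x ∈ LieAlgebra.rootSpace 𝔱 α) (z : 𝔤) :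
    ψ.covector χ k (cartanProj (𝔱 := 𝔱) ⁅x, z⁆) = 0 := by
  obtain ⟨c, hc, rfl⟩ := exists_finsupp_rootSpace 𝔱 z
  rw [Finsupp.sum, lie_sum, map_sum, map_sum]
  refine Finset.sum_eq_zero fun β _ => ?_
  by_cases h : α + β = 0
  · obtain rfl : β = -α := (neg_eq_of_add_eq_zero_right h).symm
    exact ψ.covector_cartanProj_lie χ hα hx (hc _)
  · rw [cartanProj_lie_eq_zero h hx (hc β), map_zero]

/-- A root in φ_i stays in φ_k for every k = i + j, so λ_k annihilates the corresponding brackets.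
-/
theorem leviAlgebra_le_stabiliser :
    ψ.leviAlgebra r ≤ coadjointStabiliser (extendByZero (ψ.covector χ)) := by
  intro Y hY
  rw [mem_coadjointStabiliser_iff]
  intro Z
  rw [extendByZero_lie]
  refine Finset.sum_eq_zero fun i _ => Finset.sum_eq_zero fun j _ =>
    Finset.sum_eq_zero fun k _ => ?_
  split_ifs with h
  · have hYi : Y i ∈ rootSum 𝔱 ({0} ∪ ψ.levi i) := by
      rw [← cartan_sup_rootSum]
      exact hY i
    have hle : rootSum 𝔱 ({0} ∪ ψ.levi i) ≤ LinearMap.ker (ψ.covector χ k ∘ₗ cartanProj ∘ₗ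
        (LieModule.toEnd ℂ 𝔤 𝔤 (Z j) : 𝔤 →ₗ[ℂ] 𝔤)) := by
      refine iSup₂_le fun α hα x hx => ?_
      rw [LinearMap.mem_ker]
      change ψ.covector χ k (cartanProj ⁅Z j, x⁆) = 0
      rw [← lie_skew, map_neg, map_neg, neg_eq_zero]
      exact ψ.covector_cartanProj_lie_of_mem χ
        (Set.union_subset_union_right _ (ψ.monotone_levi (by omega)) hα) hx _
    have := LinearMap.mem_ker.1 (hle hYi)
    change ψ.covector χ k (cartanProj ⁅Z j, Y i⁆) = 0 at this
    rwa [← lie_skew, map_neg, map_neg, neg_eq_zero] at this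
  · rfl

end Character

theorem extendByZero_lie_eq_zero_of_rootSum {lam : Fin r → Module.Dual ℂ 𝔱}
    {A B : ℕ → Set (Module.Dual ℂ 𝔱)} (h : ∀ i j, ∀ α ∈ A i, ∀ β ∈ B j, α + β ≠ 0)
    {Y Z : Tcla 𝔤 r} (hY : Y ∈ graded r fun i => rootSum 𝔱 (A i))
    (hZ : Z ∈ graded r fun i => rootSum 𝔱 (B i)) : extendByZero lam ⁅Y, Z⁆ = 0 := by
  rw [extendByZero_lie]
  refine Finset.sum_eq_zero fun i _ => Finset.sum_eq_zero fun j _ =>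
    Finset.sum_eq_zero fun k _ => ?_
  have h1 : cartanProj (𝔱 := 𝔱) ⁅Y i, Z j⁆ = 0 := by
    have hle : ∀ x ∈ rootSum 𝔱 (A i), rootSum 𝔱 (B j) ≤ LinearMap.ker (cartanProj (𝔱 := 𝔱) ∘ₗ
        (LieModule.toEnd ℂ 𝔤 𝔤 x : 𝔤 →ₗ[ℂ] 𝔤)) := by
      intro x hx
      refine iSup₂_le fun β hβ y hy => ?_
      have hle' : rootSum 𝔱 (A i) ≤ LinearMap.ker (cartanProj (𝔱 := 𝔱) ∘ₗ
          (LieModule.toEnd ℂ 𝔤 𝔤 y : 𝔤 →ₗ[ℂ] 𝔤)) := by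
        refine iSup₂_le fun α hα w hw => ?_
        exact cartanProj_lie_eq_zero (by rw [add_comm]; exact h i j α hα β hβ) hy hw
      have := LinearMap.mem_ker.1 (hle' hx)
      change cartanProj (𝔱 := 𝔱) ⁅y, x⁆ = 0 at this
      rwa [← lie_skew, map_neg, neg_eq_zero] at this
    exact hle _ (hY i) (hZ j)
  rw [h1, map_zero, ite_self]

theorem extendByZero_lie_uPlus {lam : Fin r → Module.Dual ℂ 𝔱} {Y Z : Tcla 𝔤 r}
    (hY : Y ∈ ψ.uPlus r) (hZ : Z ∈ ψ.uPlus r) : extendByZero lam ⁅Y, Z⁆ = 0 :=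
  extendByZero_lie_eq_zero_of_rootSum
    (fun _ _ _ hα _ hβ => ψ.add_ne_zero_of_mem_nil hα hβ) hY hZ

theorem extendByZero_lie_uMinus {lam : Fin r → Module.Dual ℂ 𝔱} {Y Z : Tcla 𝔤 r}
    (hY : Y ∈ ψ.uMinus r) (hZ : Z ∈ ψ.uMinus r) : extendByZero lam ⁅Y, Z⁆ = 0 :=
  extendByZero_lie_eq_zero_of_rootSum (A := fun i => -ψ.nil i) (B := fun i => -ψ.nil i)
    (fun _ _ α hα β hβ h => ψ.add_ne_zero_of_mem_nil hα hβ
      (by rw [← neg_add, h, neg_zero])) hY hZ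

end ParabolicFiltration


/-! ### Linear forms on the Cartan subalgebra and coroots. -/

section Reductive

variable {𝔤 : Type*} [LieRing 𝔤] [LieAlgebra ℂ 𝔤] [FiniteDimensional ℂ 𝔤]
  [LieAlgebra.HasCentralRadical ℂ 𝔤] {𝔱 : LieSubalgebra ℂ 𝔤} [𝔱.IsCartanSubalgebra]

/-- For a nonzero `e ∈ 𝔤_α`, a linear form on `𝔱` that vanishes on `[e, 𝔤_{-α}]` vanishes on the
coroot space of `α`. -/
theorem apply_eq_zero_of_mem_corootSpace {α : Module.Dual ℂ 𝔱} (hα : α ≠ 0)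
    {e : 𝔤} (he : e ∈ LieAlgebra.rootSpace 𝔱 α) (he0 : e ≠ 0) {l : Module.Dual ℂ 𝔱}
    (hl : ∀ z ∈ LieAlgebra.rootSpace 𝔱 (-α : 𝔱 → ℂ), l (cartanProj (𝔱 := 𝔱) ⁅e, z⁆) = 0)
    {h : 𝔱} (hh : h ∈ LieAlgebra.corootSpace (α : 𝔱 → ℂ)) : l h = 0 := by
  have hle : Submodule.span ℂ {⁅y, z⁆ | (y ∈ LieAlgebra.rootSpace 𝔱 α)
      (z ∈ LieAlgebra.rootSpace 𝔱 (-α : 𝔱 → ℂ))} ≤ LinearMap.ker (l ∘ₗ cartanProj (𝔱 := 𝔱)) := by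
    rw [Submodule.span_le]
    rintro _ ⟨y, hy, z, hz, rfl⟩
    obtain ⟨c, rfl⟩ := LieAlgebra.exists_smul_eq_of_mem_rootSpace hα he he0 hy
    change l (cartanProj ⁅c • e, z⁆) = 0
    rw [smul_lie, map_smul, map_smul, hl z hz, smul_zero]
  have := LinearMap.mem_ker.1 (hle (LieAlgebra.mem_corootSpace (α : 𝔱 → ℂ) |>.1 hh))
  rwa [LinearMap.comp_apply, cartanProj_of_mem h.2] at this

/-- A linear form on `𝔱` that vanishes on the coroot of `α` vanishes on `[𝔤_α, 𝔤_{-α}]`. -/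
theorem apply_cartanProj_lie_eq_zero {α : Module.Dual ℂ 𝔱} (hα : α ∈ roots 𝔱)
    {h : 𝔱} (hh : h ∈ LieAlgebra.corootSpace (α : 𝔱 → ℂ)) (h2 : α h = 2) {l : Module.Dual ℂ 𝔱}
    (hl : l h = 0) {e z : 𝔤} (he : e ∈ LieAlgebra.rootSpace 𝔱 α)
    (hz : z ∈ LieAlgebra.rootSpace 𝔱 (-α : 𝔱 → ℂ)) :
    l (cartanProj (𝔱 := 𝔱) ⁅e, z⁆) = 0 := by
  by_contra hne
  have he0 : e ≠ 0 := by
    rintro rfl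
    simp at hne
  have hz0 : z ≠ 0 := by
    rintro rfl
    simp at hne
  have hH : ⁅e, z⁆ ∈ 𝔱 := by
    have := LieAlgebra.lie_mem_genWeightSpace_of_mem_genWeightSpace he hz
    rw [add_neg_cancel] at this
    exact mem_of_mem_rootSpace_zero this
  -- As g_α and g_{-α} are lines, h is a multiple of [e, z]. Since the form kills h but not [e, z],
  -- the multiple is zero, against α h = 2.
  have hmem : h ∈ Submodule.span ℂ {(⟨⁅e, z⁆, hH⟩ : 𝔱)} := by
    have hle : Submodule.span ℂ {⁅y, w⁆ | (y ∈ LieAlgebra.rootSpace 𝔱 α)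
        (w ∈ LieAlgebra.rootSpace 𝔱 (-α : 𝔱 → ℂ))} ≤ Submodule.span ℂ {⁅e, z⁆} := by
      rw [Submodule.span_le]
      rintro _ ⟨y, hy, w, hw, rfl⟩
      obtain ⟨a, rfl⟩ := LieAlgebra.exists_smul_eq_of_mem_rootSpace hα.1 he he0 hy
      obtain ⟨b, rfl⟩ := LieAlgebra.exists_smul_eq_of_mem_rootSpace (α := -α)
        (neg_ne_zero.2 hα.1) hz hz0 hw
      rw [smul_lie, lie_smul]
      exact Submodule.smul_mem _ _ (Submodule.smul_mem _ _ (Submodule.mem_span_singleton_self _))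
    obtain ⟨c, hc⟩ := Submodule.mem_span_singleton.1
      (hle (LieAlgebra.mem_corootSpace (α : 𝔱 → ℂ) |>.1 hh))
    exact Submodule.mem_span_singleton.2 ⟨c, Subtype.ext hc⟩
  obtain ⟨c, rfl⟩ := Submodule.mem_span_singleton.1 hmem
  rw [cartanProj_of_mem hH] at hne
  rw [map_smul, smul_eq_zero] at hl
  rw [hl.resolve_right hne, zero_smul, map_zero] at h2
  exact two_ne_zero h2.symm

end Reductive

namespace ParabolicFiltration

attribute [local instance] LieRing.ofAssociativeRing

/-! ### Nonsingularity, nondegeneracy, the KKS form and the stabiliser. -/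

section General

variable {𝔤 : Type*} [LieRing 𝔤] [LieAlgebra ℂ 𝔤] [FiniteDimensional ℂ 𝔤]
  {𝔱 : LieSubalgebra ℂ 𝔤} [𝔱.IsCartanSubalgebra] (ψ : ParabolicFiltration 𝔱) {r : ℕ}
  (χ : LieAlgebra.LieCharacter ℂ (ψ.singularityAlgebra r))

theorem isNonsingular_iff : ψ.IsNonsingular (ψ.restrictLevi χ) ↔
    (ψ.pairing (ψ.restrictLevi χ)).Nondegenerate := by
  refine ⟨fun h => h.2, fun h => ⟨⟨χ, rfl, fun Y hY => ?_⟩, h⟩⟩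
  rw [← extendByZero_covector_apply]
  exact extendByZero_eq_zero_of_mem ψ (Submodule.mem_sup_right hY)

theorem apply_lie_levi {Y P : Tcla 𝔤 r} (hP : P ∈ ψ.leviAlgebra r) :
    extendByZero (ψ.covector χ) ⁅Y, P⁆ = 0 := by
  rw [← lie_skew, map_neg, apply_lie_of_mem_stabiliser (ψ.leviAlgebra_le_stabiliser χ hP),
    neg_zero]

theorem exists_add_eq (Y : Tcla 𝔤 r) : ∃ P ∈ ψ.leviAlgebra r, ∃ A ∈ ψ.uMinus r,
    ∃ B ∈ ψ.uPlus r, P + (A + B) = Y := by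
  have hY : Y ∈ (ψ.leviAlgebra r).toSubmodule ⊔ (ψ.uMinus r ⊔ ψ.uPlus r) := by
    rw [(ψ.isCompl_levi r).sup_eq_top]
    trivial
  obtain ⟨P, hP, C, hC, rfl⟩ := Submodule.mem_sup.1 hY
  obtain ⟨A, hA, B, hB, rfl⟩ := Submodule.mem_sup.1 hC
  exact ⟨P, hP, A, hA, B, hB, rfl⟩

/-- Orthogonality to l_φ and to u⁺ is automatic, so only u⁻ has to be tested. -/
theorem mem_stabiliser_of_uPlus {Y : Tcla 𝔤 r} (hY : Y ∈ ψ.uPlus r)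
    (h : ∀ Z ∈ ψ.uMinus r, extendByZero (ψ.covector χ) ⁅Y, Z⁆ = 0) :
    Y ∈ coadjointStabiliser (extendByZero (ψ.covector χ)) := by
  rw [mem_coadjointStabiliser_iff]
  intro Z
  obtain ⟨P, hP, A, hA, B, hB, rfl⟩ := ψ.exists_add_eq Z
  rw [lie_add, lie_add, map_add, map_add, ψ.apply_lie_levi χ hP, h A hA,
    ψ.extendByZero_lie_uPlus hY hB, add_zero, add_zero]

theorem mem_stabiliser_of_uMinus {Y : Tcla 𝔤 r} (hY : Y ∈ ψ.uMinus r)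
    (h : ∀ Z ∈ ψ.uPlus r, extendByZero (ψ.covector χ) ⁅Z, Y⁆ = 0) :
    Y ∈ coadjointStabiliser (extendByZero (ψ.covector χ)) := by
  rw [mem_coadjointStabiliser_iff]
  intro Z
  obtain ⟨P, hP, A, hA, B, hB, rfl⟩ := ψ.exists_add_eq Z
  have hB' : extendByZero (ψ.covector χ) ⁅Y, B⁆ = 0 := by
    rw [← lie_skew, map_neg, h B hB, neg_zero]
  rw [lie_add, lie_add, map_add, map_add, ψ.apply_lie_levi χ hP, hB',
    ψ.extendByZero_lie_uMinus hY hA, add_zero, add_zero]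

/-- The stabiliser is at least `𝔩_φ`, with equality if and only if it meets the complement
`𝔲^- ⊕ 𝔲^+` trivially. -/
theorem leviAlgebra_eq_iff_disjoint :
    ψ.leviAlgebra r = coadjointStabiliser (extendByZero (ψ.covector χ)) ↔
      Disjoint (coadjointStabiliser (extendByZero (ψ.covector χ))).toSubmodule
        (ψ.uMinus r ⊔ ψ.uPlus r) := by
  constructor
  · intro h
    rw [← h]
    exact (ψ.isCompl_levi r).disjoint
  · intro h
    refine le_antisymm (ψ.leviAlgebra_le_stabiliser χ) fun Y hY => ?_
    obtain ⟨P, hP, A, hA, B, hB, rfl⟩ := ψ.exists_add_eq Y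
    have h1 := sub_mem hY (ψ.leviAlgebra_le_stabiliser χ hP)
    rw [add_sub_cancel_left] at h1
    rw [Submodule.disjoint_def.1 h _ h1 (Submodule.add_mem_sup hA hB), add_zero]
    exact hP

/-- By isotropy, pairing A + B with u⁻ sees only B, and pairing it with u⁺ sees only A. The
stabiliser's intersection with u⁻ ⊕ u⁺ thus splits into the two kernels of the pairing. -/
theorem nondegenerate_iff_disjoint : (ψ.pairing (ψ.restrictLevi χ)).Nondegenerate ↔
    Disjoint (coadjointStabiliser (extendByZero (ψ.covector χ))).toSubmodule
      (ψ.uMinus r ⊔ ψ.uPlus r) := by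
  constructor
  · rintro ⟨hl, hr⟩
    rw [Submodule.disjoint_def]
    intro Y hY hY'
    obtain ⟨A, hA, B, hB, rfl⟩ := Submodule.mem_sup.1 hY'
    have hs := (mem_coadjointStabiliser_iff).1 hY
    have hB0 : (⟨B, hB⟩ : ψ.uPlus r) = 0 := by
      refine hl _ fun Z => ?_
      rw [pairing_apply]
      have := hs Z
      rwa [add_lie, map_add, ψ.extendByZero_lie_uMinus hA Z.2, zero_add] at this
    have hA0 : (⟨A, hA⟩ : ψ.uMinus r) = 0 := by
      refine hr _ fun Z => ?_
      rw [pairing_apply, ← lie_skew, map_neg, neg_eq_zero]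
      have := hs Z
      rwa [add_lie, map_add, ψ.extendByZero_lie_uPlus hB Z.2, add_zero] at this
    rw [show A = 0 from congrArg Subtype.val hA0, show B = 0 from congrArg Subtype.val hB0,
      add_zero]
  · intro h
    rw [Submodule.disjoint_def] at h
    refine ⟨fun Y hY => Subtype.ext (h _ (ψ.mem_stabiliser_of_uPlus χ Y.2 fun Z hZ => ?_)
      (Submodule.mem_sup_right Y.2)), fun Y hY => Subtype.ext
      (h _ (ψ.mem_stabiliser_of_uMinus χ Y.2 fun Z hZ => ?_) (Submodule.mem_sup_left Y.2))⟩
    · rw [← ψ.pairing_apply χ Y ⟨Z, hZ⟩]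
      exact hY _
    · rw [← ψ.pairing_apply χ ⟨Z, hZ⟩ Y]
      exact hY _

theorem disjoint_uMinus_uPlus : Disjoint (ψ.uMinus r) (ψ.uPlus r) := by
  rw [Submodule.disjoint_def]
  intro Y hA hB
  ext i
  have hd : Disjoint (ψ.nil i) (-ψ.nil i) := by
    rw [Set.disjoint_left]
    exact fun α hα hα' => ψ.add_ne_zero_of_mem_nil hα hα' (add_neg_cancel α)
  exact Submodule.disjoint_def.1 (disjoint_rootSum hd) (Y i) (hB i) (hA i)

/-- The equality of the two forms always holds; the content is the injectivity. -/
theorem pairingIsKKS_iff_disjoint :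
    ψ.PairingIsKKS (ψ.restrictLevi χ) (extendByZero (ψ.covector χ)) ↔
      Disjoint (coadjointStabiliser (extendByZero (ψ.covector χ))).toSubmodule
        (ψ.uMinus r ⊔ ψ.uPlus r) := by
  constructor
  · rintro ⟨hinj, -⟩
    rw [Submodule.disjoint_def]
    intro Y hY hY'
    obtain ⟨A, hA, B, hB, rfl⟩ := Submodule.mem_sup.1 hY'
    have h0 := @hinj (⟨B, hB⟩, ⟨A, hA⟩) 0 (by
      refine (Submodule.Quotient.eq _).2 ?_
      simpa [add_comm] using hY)
    have hB0 : B = 0 := congrArg Subtype.val (congrArg Prod.fst h0)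
    have hA0 : A = 0 := congrArg Subtype.val (congrArg Prod.snd h0)
    rw [hA0, hB0, add_zero]
  · intro h
    refine ⟨?_, fun Y Y' => by rw [pairing_apply, kksForm_mk]⟩
    rintro ⟨B, A⟩ ⟨B', A'⟩ hAB
    have h1 := (Submodule.Quotient.eq _).1 hAB
    have h2 : ((B : Tcla 𝔤 r) + A) - (B' + A') = (A - A') + (B - B') := by abel
    rw [h2] at h1
    have h3 := Submodule.disjoint_def.1 h _ h1
      (Submodule.add_mem_sup (sub_mem A.2 A'.2) (sub_mem B.2 B'.2))
    have h4 : (A - A' : Tcla 𝔤 r) = 0 := by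
      refine Submodule.disjoint_def.1 ψ.disjoint_uMinus_uPlus _ (sub_mem A.2 A'.2) ?_
      rw [eq_neg_of_add_eq_zero_left h3]
      exact neg_mem (sub_mem B.2 B'.2)
    rw [h4, zero_add] at h3
    exact Prod.ext (Subtype.ext (sub_eq_zero.1 h3)) (Subtype.ext (sub_eq_zero.1 h4))

theorem covector_eq_zero_of_mem_corootSpace {k : Fin r} {α : Module.Dual ℂ 𝔱}
    (hα : α ∈ ψ.levi k) {h : 𝔱} (hh : h ∈ LieAlgebra.corootSpace (α : 𝔱 → ℂ)) :
    ψ.covector χ k h = 0 := by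
  have hle : Submodule.span ℂ {⁅y, z⁆ | (y ∈ LieAlgebra.rootSpace 𝔱 α)
      (z ∈ LieAlgebra.rootSpace 𝔱 (-α : 𝔱 → ℂ))} ≤
      LinearMap.ker (ψ.covector χ k ∘ₗ cartanProj (𝔱 := 𝔱)) := by
    rw [Submodule.span_le]
    rintro _ ⟨y, hy, z, hz, rfl⟩
    exact ψ.covector_cartanProj_lie χ (Or.inr hα) hy hz
  have := LinearMap.mem_ker.1 (hle (LieAlgebra.mem_corootSpace (α : 𝔱 → ℂ) |>.1 hh))
  rwa [LinearMap.comp_apply, cartanProj_of_mem h.2] at this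

end General

/-! ### The wild stratum and the stabiliser. -/

section Reductive

variable {𝔤 : Type*} [LieRing 𝔤] [LieAlgebra ℂ 𝔤] [FiniteDimensional ℂ 𝔤]
  [LieAlgebra.HasCentralRadical ℂ 𝔤]
  {𝔱 : LieSubalgebra ℂ 𝔤} [𝔱.IsCartanSubalgebra] (ψ : ParabolicFiltration 𝔱) {r : ℕ}
  (χ : LieAlgebra.LieCharacter ℂ (ψ.singularityAlgebra r))

theorem leviAlgebra_eq_of_mem_dualWildStratum (hψ : ψ.set r = roots 𝔱)
    (h : ψ.covector χ ∈ dualWildStratum r ψ.dualLevi) :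
    ψ.leviAlgebra r = coadjointStabiliser (extendByZero (ψ.covector χ)) := by
  refine le_antisymm (ψ.leviAlgebra_le_stabiliser χ) fun Y hY => ?_
  have hs := mem_coadjointStabiliser_iff.1 hY
  choose c hc hcY using fun i => exists_finsupp_rootSpace 𝔱 (Y i)
  -- Strong induction on the degree n: the α-component of Y_n vanishes unless α ∈ φ_n.
  have key : ∀ (n : ℕ) (hn : n < r), ∀ α ∈ roots 𝔱, α ∉ ψ.levi n → c ⟨n, hn⟩ α = 0 := by
    intro n
    induction n using Nat.strong_induction_on with
    | _ n ih =>
    intro hn α hα hαn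
    by_contra hne
    classical
    have hex : ∃ d, α ∈ ψ.levi d := ⟨r, by rwa [ψ.levi_eq_roots hψ]⟩
    -- d is the last index with α ∉ φ_d; it exists and satisfies n ≤ d < r because α ∉ φ_n and φ_r =
    -- Φ.
    obtain ⟨d, hd⟩ : ∃ d, d + 1 = Nat.find hex := by
      refine ⟨Nat.find hex - 1, Nat.sub_add_cancel (Nat.pos_of_ne_zero fun h0 => hαn ?_)⟩
      have := Nat.find_spec hex
      rw [h0] at this
      exact ψ.monotone_levi (Nat.zero_le n) this
    have hd1 : α ∈ ψ.levi (d + 1) := hd ▸ Nat.find_spec hex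
    have hd0 : α ∉ ψ.levi d := Nat.find_min hex (by omega)
    have hnd : n ≤ d := by
      by_contra hlt
      exact hαn (ψ.monotone_levi (by omega) hd1)
    have hdr : d < r := by
      by_contra hlt
      refine hd0 (ψ.monotone_levi (not_lt.1 hlt) ?_)
      rwa [ψ.levi_eq_roots hψ]
    obtain ⟨t, ht, ht2⟩ := LieAlgebra.exists_mem_corootSpace_apply_eq_two hα.1 hα.2
    refine (h ⟨d, hdr⟩).2 t ⟨⟨α, hd1, ht, ht2⟩, ?_⟩ ?_
    -- The stratum is phrased with coroots: α^∨ could lie in φ_d^∨ through another root, which is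
    -- excluded since a coroot determines its root.
    · rintro ⟨β, hβ, htβ, htβ2⟩
      have hβr := ψ.set_subset_roots d hβ.1
      rw [LieAlgebra.eq_of_mem_corootSpace_of_apply_eq_two hα.1 hα.2 hβr.1 hβr.2 ht htβ ht2 htβ2]
        at hd0
      exact hd0 hβ
    · refine apply_eq_zero_of_mem_corootSpace hα.1 (hc ⟨n, hn⟩ α) hne (fun z hz => ?_) ht
      -- The degree d - n makes Y_n contribute through λ_d. The α-components of Y_j with j < n
      -- vanish by induction; for j > n the form is λ_k with k > d, which kills [g_α, g_{-α}].
      have h1 := hs (mono ⟨d - n, by omega⟩ z)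
      rw [extendByZero_lie_mono, Finset.sum_eq_single ⟨n, hn⟩,
        Finset.sum_eq_single ⟨d, hdr⟩, if_pos (Nat.add_sub_cancel' hnd), ← hcY ⟨n, hn⟩,
        cartanProj_lie_sum (hc ⟨n, hn⟩) hz] at h1
      · exact h1
      · intro k _ hk
        refine if_neg fun h' => hk (Fin.ext ?_)
        change n + (d - n) = k at h'
        change (k : ℕ) = d
        omega
      · simp
      · intro j _ hj
        refine Finset.sum_eq_zero fun k _ => ?_
        split_ifs with hjk
        · change (j : ℕ) + (d - n) = k at hjk
          rw [← hcY j, cartanProj_lie_sum (hc j) hz]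
          have hjn : (j : ℕ) ≠ n := fun h' => hj (Fin.ext h')
          rcases lt_or_gt_of_ne hjn with hlt | hgt
          · rw [ih j hlt j.2 α hα fun h' => hαn (ψ.monotone_levi hlt.le h'), zero_lie, map_zero,
              map_zero]
          · exact ψ.covector_cartanProj_lie χ
              (Or.inr (ψ.monotone_levi (by omega) hd1)) (hc j α) hz
        · rfl
      · simp
  intro i
  change Y i ∈ 𝔱.toSubmodule ⊔ rootSum 𝔱 (ψ.levi i)
  rw [cartan_sup_rootSum, ← hcY i]
  refine Submodule.sum_mem _ fun α _ => ?_
  by_cases hα : α ∈ ({0} ∪ ψ.levi i : Set (Module.Dual ℂ 𝔱))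
  · exact rootSpace_le_rootSum hα (hc i α)
  · have hα' : c i α = 0 := by
      by_cases hb : LieAlgebra.rootSpace 𝔱 (α : 𝔱 → ℂ) = ⊥
      · have := hc i α
        rwa [hb, LieSubmodule.mem_bot] at this
      · exact key i i.2 α ⟨fun h0 => hα (Or.inl h0), hb⟩ fun h' => hα (Or.inr h')
    rw [hα']
    exact Submodule.zero_mem _

theorem mem_dualWildStratum_of_leviAlgebra_eq
    (h : ψ.leviAlgebra r = coadjointStabiliser (extendByZero (ψ.covector χ))) :
    ψ.covector χ ∈ dualWildStratum r ψ.dualLevi := by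
  refine fun i => ⟨?_, ?_⟩
  · rintro t ⟨α, hα, ht, -⟩
    exact ψ.covector_eq_zero_of_mem_corootSpace χ hα ht
  · rintro t ⟨⟨α, hα, ht, ht2⟩, hti⟩ h0
    have hαi : α ∉ ψ.levi i := fun h' => hti ⟨α, h', ht, ht2⟩
    have hαr := ψ.set_subset_roots _ hα.1
    obtain ⟨e, he, he0⟩ := LieAlgebra.exists_mem_ne_zero_of_rootSpace_ne_bot hαr.2
    -- If λ_i(α^∨) = 0, then e ε^i stabilises the covector: degree 0 of Z tests λ_i, and a positive
    -- degree tests λ_k with k > i, where α ∈ φ_k already. But α ∉ φ_i keeps e ε^i out of l_φ.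
    have hmem : mono i e ∈ ψ.leviAlgebra r := by
      rw [h, mem_coadjointStabiliser_iff]
      intro Z
      rw [← lie_skew, map_neg, extendByZero_lie_mono, neg_eq_zero]
      refine Finset.sum_eq_zero fun j _ => Finset.sum_eq_zero fun k _ => ?_
      split_ifs with hjk
      · rw [← lie_skew, map_neg, map_neg, neg_eq_zero]
        rcases Nat.eq_zero_or_pos (j : ℕ) with hj | hj
        · obtain rfl : k = i := Fin.ext (by omega)
          obtain ⟨c, hc, hcZ⟩ := exists_finsupp_rootSpace 𝔱 (Z j)
          rw [← lie_skew, map_neg, map_neg, neg_eq_zero, ← hcZ,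
            cartanProj_lie_sum (α := -α) hc (by rwa [neg_neg]), ← lie_skew, map_neg, map_neg,
            neg_eq_zero]
          exact apply_cartanProj_lie_eq_zero hαr ht ht2 h0 he (hc (-α))
        · exact ψ.covector_cartanProj_lie_of_mem χ
            (Or.inr (ψ.monotone_levi (by omega) hα)) he _
      · rfl
    have hei : e ∈ rootSum 𝔱 ({0} ∪ ψ.levi i) := by
      have := hmem i
      rw [mono_same] at this
      rw [← cartan_sup_rootSum]
      exact this
    have hd : Disjoint ({α} : Set (Module.Dual ℂ 𝔱)) ({0} ∪ ψ.levi i) := by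
      rw [Set.disjoint_singleton_left]
      rintro (h' | h')
      · exact hαr.1 h'
      · exact hαi h'
    exact he0 (Submodule.disjoint_def.1 (disjoint_rootSum hd) e
      (rootSpace_le_rootSum (Set.mem_singleton α) he) hei)

end Reductive

end ParabolicFiltration

end WildKKS

theorem mainTheorem9 {𝔤 : Type*} [LieRing 𝔤] [LieAlgebra ℂ 𝔤] [FiniteDimensional ℂ 𝔤]
    [LieAlgebra.HasCentralRadical ℂ 𝔤]
    (𝔱 : LieSubalgebra ℂ 𝔤) [𝔱.IsCartanSubalgebra]
    (r : ℕ) (hr : 1 ≤ r)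
    (ψ : WildKKS.ParabolicFiltration 𝔱) (hψ : ψ.set r = WildKKS.roots 𝔱)
    (χ : LieAlgebra.LieCharacter ℂ (ψ.singularityAlgebra r)) :
    List.TFAE [
      ψ.IsNonsingular (ψ.restrictLevi χ),
      (ψ.pairing (ψ.restrictLevi χ)).Nondegenerate,
      ψ.covector χ ∈ WildKKS.dualWildStratum r ψ.dualLevi,
      ψ.PairingIsKKS (ψ.restrictLevi χ) (WildKKS.extendByZero (ψ.covector χ)),
      ψ.leviAlgebra r = WildKKS.coadjointStabiliser (WildKKS.extendByZero (ψ.covector χ))] := by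
  tfae_have 1 ↔ 2 := ψ.isNonsingular_iff χ
  tfae_have 2 ↔ 5 := (ψ.nondegenerate_iff_disjoint χ).trans (ψ.leviAlgebra_eq_iff_disjoint χ).symm
  tfae_have 4 ↔ 5 := (ψ.pairingIsKKS_iff_disjoint χ).trans (ψ.leviAlgebra_eq_iff_disjoint χ).symm
  tfae_have 3 → 5 := ψ.leviAlgebra_eq_of_mem_dualWildStratum χ hψ
  tfae_have 5 → 3 := ψ.mem_dualWildStratum_of_leviAlgebra_eq χ
  tfae_finish
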